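/- Let $\mathcal B$ be a bicategory which is locally cocomplete (every hom-category has all small colimits) and closed (all right Kan extensions and all right Kan lifts exist). A $\mathcal B$-category $(M,A)$ is a small set $A$ with a map $t:A\to \mathrm{Ob}(\mathcal B)$, $1$-cells $M(a,b):tb\to ta$, and $2$-cells $\iota_{abc}:M(a,b)M(b,c)\Rightarrow M(a,c)$ and $\rho_a:\mathrm{id}_{ta}\Rightarrow M(a,a)$ that are associative and unital. A distributor $\phi:(M,A)\to(N,C)$ consists of $1$-cells $\phi(c,a):ta\to tc$ and $2$-cells $\delta_{c,c',a',a}:N(c,c')\phi(c',a')M(a',a)\Rightarrow\phi(c,a)$ that are unital with respect to the $\rho$'s and associative with respect to the $\iota$'s. Its one-sided actions are $\delta_{c,c',a,a}\bullet(1*\rho_a):N(c,c')\phi(c',a)\Rightarrow\phi(c,a)$ and $\delta_{c,c,a',a}\bullet(\rho_c*1):\phi(c,a')M(a',a)\Rightarrow\phi(c,a)$. A morphism of distributors $f:\phi_1\to\phi_2$ is a family of $2$-cells $f_{ca}:\phi_1(c,a)\Rightarrow\phi_2(c,a)$ commuting with both one-sided actions; vertical composition is pointwise. A composite of $\phi:(M,A)\to(N,C)$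 and $\psi:(N,C)\to(P,D)$ is a distributor $\psi\phi:(M,A)\to(P,D)$ with $2$-cells $e_c:\psi(d,c)\phi(c,a)\Rightarrow(\psi\phi)(d,a)$ such that, for all $d,a$, the family $(e_c)_c$ is universal among the families that coequalize the two $2$-cells $\psi(d,c_1)N(c_1,c_2)\phi(c_2,a)\Rightarrow\psi(d,c_i)\phi(c_i,a)$ ($i=1,2$) given by the one-sided actions (that is, $(\psi\phi)(d,a)=\int^{c}_{N}\psi(d,c)\phi(c,a)$), and such that the double action of $\psi\phi$ is the one induced through the $e_c$ by the one-sided actions of $\psi$ and $\phi$. Then: 1. Every composable pair of distributors has a composite. 2. The matrix $M$ of a $\mathcal B$-category $(M,A)$, with double action the iterated $\iota$, is a distributor $(M,A)\to(M,A)$ and is an identity for composition: every $\phi:(M,A)\to(N,C)$, with its one-sided actions $\phi(c,a')M(a',a)\Rightarrow\phi(c,a)$ (respectively $N(c,c')\phi(c',a)\Rightarrow\phi(c,a)$) as the universal family, is a composite of $M$ and $\phi$ (respectively of $\phi$ and $N$). 3. For every choice of composites, the $\mathcal B$-categories, distributors and morphisms of distributors form a bicategory $\mathrm{Dist}(\mathcal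 B)$ whose composition of $1$-cells is the chosen one, whose identity $1$-cells are the distributors $M$, whose vertical composition is pointwise, whose horizontal composition is induced by the $2$-cells $g_{dc}*f_{ca}$ through the universal property of the coends, and whose associators and unitors are induced, through the same universal property, by the associators of $\mathcal B$ and by the one-sided actions. 4. Call an involution on a bicategory a pseudofunctor $f\mapsto f^\circ$ from its opposite ($1$-cells reversed) to itself which is the identity on objects and whose square is the identity pseudofunctor. Suppose that $\mathcal B$ has an involution. Call $(M,A)$ symmetric if $M(a,b)=M(b,a)^\circ$, $\rho_a^\circ=\rho_a$ and $\iota_{abc}^\circ=\iota_{cba}$ (modulo the structural $2$-cells of the involution), and let $\mathrm{Dist}_{\mathrm s}(\mathcal B)$ be the full sub-bicategory of $\mathrm{Dist}(\mathcal B)$ on the symmetric $\mathcal B$-categories. Then $\mathrm{Dist}_{\mathrm s}(\mathcal B)$ has an involution, with $\phi^\circ(a,c)=\phi(c,a)^\circ$, $\delta^{\phi^\circ}=(\delta^\phi)^\circ$ and $(f^\circ)_{ac}=(f_{ca})^\circ$, and with structural $2$-cells induced by those of the involution of $\mathcal B$. -/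

import Mathlib

open CategoryTheory Bicategory

universe s w v u

namespace EnrichedBicat

/-! ### Standing assumptions on the base bicategory

Mathlib writes composition diagrammatically: the composite `g f` of `f : x ⟶ y` and `g : y ⟶ z`
is `f ≫ g`. -/

/-- A bicategory is closed if all right Kan extensions and all right Kan lifts exist. -/
structure IsClosedBicategory (B : Type u) [Bicategory.{w, v} B] : Prop where
  exists_rightKanExtension : ∀ {x y z : B} (f : x ⟶ y) (g : x ⟶ z),
    ∃ t : RightExtension f g, Nonempty t.IsUniversal
  exists_rightKanLift : ∀ {x y z : B} (f : y ⟶ x) (g : z ⟶ x),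
    ∃ t : RightLift f g, Nonempty t.IsUniversal

/-- A bicategory is locally cocomplete if its hom-categories have all (`s`-small) colimits. -/
def IsLocallyCocomplete (B : Type u) [Bicategory.{w, v} B] : Prop :=
  ∀ x y : B, Limits.HasColimitsOfSize.{s, s} (x ⟶ y)

/-- An involution on a bicategory: a pseudofunctor `f ↦ f°` from the opposite bicategory
(1-cells reversed, 2-cells not) to the bicategory which is the identity on objects and whose
square is the identity pseudofunctor. The last four fields say the latter, on 1-cells, on 2-cells,
and on the structural 2-cells. -/
structure Involution (B : Type u) [Bicategory.{w, v} B] where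
  inv : ∀ {x y : B}, (x ⟶ y) → (y ⟶ x)
  inv₂ : ∀ {x y : B} {f g : x ⟶ y}, (f ⟶ g) → (inv f ⟶ inv g)
  inv₂_id : ∀ {x y : B} (f : x ⟶ y), inv₂ (𝟙 f) = 𝟙 (inv f)
  inv₂_comp : ∀ {x y : B} {f g h : x ⟶ y} (α : f ⟶ g) (β : g ⟶ h),
    inv₂ (α ≫ β) = inv₂ α ≫ inv₂ β
  invId : ∀ x : B, 𝟙 x ≅ inv (𝟙 x)
  invComp : ∀ {x y z : B} (f : x ⟶ y) (g : y ⟶ z), inv g ≫ inv f ≅ inv (f ≫ g)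
  invComp_naturality_left : ∀ {x y z : B} {f f' : x ⟶ y} (α : f ⟶ f') (g : y ⟶ z),
    (inv g ◁ inv₂ α) ≫ (invComp f' g).hom = (invComp f g).hom ≫ inv₂ (α ▷ g)
  invComp_naturality_right : ∀ {x y z : B} (f : x ⟶ y) {g g' : y ⟶ z} (β : g ⟶ g'),
    (inv₂ β ▷ inv f) ≫ (invComp f g').hom = (invComp f g).hom ≫ inv₂ (f ◁ β)
  invComp_assoc : ∀ {x y z t : B} (f : x ⟶ y) (g : y ⟶ z) (h : z ⟶ t),
    (inv h ◁ (invComp f g).hom) ≫ (invComp (f ≫ g) h).hom ≫ inv₂ (α_ f g h).hom =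
      (α_ (inv h) (inv g) (inv f)).inv ≫ ((invComp g h).hom ▷ inv f) ≫ (invComp f (g ≫ h)).hom
  invComp_id_left : ∀ {x y : B} (f : x ⟶ y),
    (inv f ◁ (invId x).hom) ≫ (invComp (𝟙 x) f).hom ≫ inv₂ (λ_ f).hom = (ρ_ (inv f)).hom
  invComp_id_right : ∀ {x y : B} (f : x ⟶ y),
    ((invId y).hom ▷ inv f) ≫ (invComp f (𝟙 y)).hom ≫ inv₂ (ρ_ f).hom = (λ_ (inv f)).hom
  inv_inv : ∀ {x y : B} (f : x ⟶ y), inv (inv f) = f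
  inv₂_inv₂ : ∀ {x y : B} {f g : x ⟶ y} (α : f ⟶ g),
    inv₂ (inv₂ α) = eqToHom (inv_inv f) ≫ α ≫ eqToHom (inv_inv g).symm
  invId_invId : ∀ x : B,
    (invId x).hom ≫ inv₂ (invId x).hom = eqToHom (inv_inv (𝟙 x)).symm
  invComp_invComp : ∀ {x y z : B} (f : x ⟶ y) (g : y ⟶ z),
    (invComp (inv g) (inv f)).hom ≫ inv₂ (invComp f g).hom =
      eqToHom ((congrArg₂ (· ≫ ·) (inv_inv f) (inv_inv g)).trans (inv_inv (f ≫ g)).symm)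

/-- The canonical 2-cell `f° g° h° ⟶ (h g f)°`. -/
def Involution.invComp₃ {B : Type u} [Bicategory.{w, v} B] (I : Involution B) {x y z t : B}
    (f : x ⟶ y) (g : y ⟶ z) (h : z ⟶ t) :
    I.inv h ≫ I.inv g ≫ I.inv f ⟶ I.inv (f ≫ g ≫ h) :=
  (α_ (I.inv h) (I.inv g) (I.inv f)).inv ≫ ((I.invComp g h).hom ▷ I.inv f) ≫
    (I.invComp f (g ≫ h)).hom

/-! ### Enriched categories, distributors and their morphisms -/

/-- A category enriched in the bicategory `B`: a set `carrier` typed by `typ`, with a matrix of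
1-cells `M(a,b) : tb ⟶ ta`, and the 2-cells `ι_{abc} : M(a,b) M(b,c) ⟹ M(a,c)` and
`ρ_a : id ⟹ M(a,a)`. -/
structure BCat (B : Type u) [Bicategory.{w, v} B] where
  carrier : Type s
  typ : carrier → B
  M : ∀ a b : carrier, typ b ⟶ typ a
  ι : ∀ a b c : carrier, M b c ≫ M a b ⟶ M a c
  ρ : ∀ a : carrier, 𝟙 (typ a) ⟶ M a a
  ι_assoc : ∀ a b c d : carrier,
    (M c d ◁ ι a b c) ≫ ι a c d = (α_ (M c d) (M b c) (M a b)).inv ≫ (ι b c d ▷ M a b) ≫ ι a b d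
  ι_ρ_source : ∀ a b : carrier, (ρ b ▷ M a b) ≫ ι a b b = (λ_ (M a b)).hom
  ι_ρ_target : ∀ a b : carrier, (M a b ◁ ρ a) ≫ ι a a b = (ρ_ (M a b)).hom

variable {B : Type u} [Bicategory.{w, v} B]

/-- A distributor `φ : (M,A) → (N,C)`: a matrix of 1-cells `φ(c,a) : ta ⟶ tc` with double action
2-cells `δ_{c,c',a',a} : N(c,c') φ(c',a') M(a',a) ⟹ φ(c,a)`. -/
@[ext]
structure Dist (X Y : BCat.{s} B) where
  hom : ∀ (c : Y.carrier) (a : X.carrier), X.typ a ⟶ Y.typ c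
  δ : ∀ (c c' : Y.carrier) (a' a : X.carrier), X.M a' a ≫ hom c' a' ≫ Y.M c c' ⟶ hom c a
  unit : ∀ (c : Y.carrier) (a : X.carrier),
    (X.ρ a ▷ (hom c a ≫ 𝟙 (Y.typ c))) ≫ (X.M a a ◁ hom c a ◁ Y.ρ c) ≫ δ c c a a =
      (λ_ (hom c a ≫ 𝟙 (Y.typ c))).hom ≫ (ρ_ (hom c a)).hom
  assoc : ∀ (c₁ c₂ c₃ : Y.carrier) (a₁ a₂ a₃ : X.carrier),
    (X.M a₂ a₁ ◁ (δ c₂ c₃ a₃ a₂ ▷ Y.M c₁ c₂)) ≫ δ c₁ c₂ a₂ a₁ =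
      (X.M a₂ a₁ ◁ ((α_ (X.M a₃ a₂) (hom c₃ a₃ ≫ Y.M c₂ c₃) (Y.M c₁ c₂)).hom ≫
          (X.M a₃ a₂ ◁ (α_ (hom c₃ a₃) (Y.M c₂ c₃) (Y.M c₁ c₂)).hom))) ≫
        (α_ (X.M a₂ a₁) (X.M a₃ a₂) (hom c₃ a₃ ≫ Y.M c₂ c₃ ≫ Y.M c₁ c₂)).inv ≫
        (X.ι a₃ a₂ a₁ ▷ (hom c₃ a₃ ≫ Y.M c₂ c₃ ≫ Y.M c₁ c₂)) ≫
        (X.M a₃ a₁ ◁ hom c₃ a₃ ◁ Y.ι c₁ c₂ c₃) ≫ δ c₁ c₃ a₃ a₁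

/-- The one-sided action `δ ∙ (1 * ρ_a) : N(c,c') φ(c',a) ⟹ φ(c,a)`. -/
def Dist.actCod {X Y : BCat.{s} B} (φ : Dist X Y) (c c' : Y.carrier) (a : X.carrier) :
    φ.hom c' a ≫ Y.M c c' ⟶ φ.hom c a :=
  (λ_ (φ.hom c' a ≫ Y.M c c')).inv ≫ (X.ρ a ▷ (φ.hom c' a ≫ Y.M c c')) ≫ φ.δ c c' a a

/-- The one-sided action `δ ∙ (ρ_c * 1) : φ(c,a') M(a',a) ⟹ φ(c,a)`. -/
def Dist.actDom {X Y : BCat.{s} B} (φ : Dist X Y) (c : Y.carrier) (a' a : X.carrier) :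
    X.M a' a ≫ φ.hom c a' ⟶ φ.hom c a :=
  (X.M a' a ◁ ((ρ_ (φ.hom c a')).inv ≫ (φ.hom c a' ◁ Y.ρ c))) ≫ φ.δ c c a' a

/-- A morphism of distributors. -/
@[ext]
structure DistHom {X Y : BCat.{s} B} (φ₁ φ₂ : Dist X Y) where
  app : ∀ (c : Y.carrier) (a : X.carrier), φ₁.hom c a ⟶ φ₂.hom c a
  app_actCod : ∀ (c₁ c₂ : Y.carrier) (a : X.carrier),
    φ₁.actCod c₁ c₂ a ≫ app c₁ a = (app c₂ a ▷ Y.M c₁ c₂) ≫ φ₂.actCod c₁ c₂ a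
  app_actDom : ∀ (c : Y.carrier) (a₁ a₂ : X.carrier),
    φ₁.actDom c a₁ a₂ ≫ app c a₂ = (X.M a₁ a₂ ◁ app c a₁) ≫ φ₂.actDom c a₁ a₂

/-- Distributors between two fixed enriched categories form a category under the pointwise
(vertical) composition of morphisms. -/
instance distCategory (X Y : BCat.{s} B) : Category (Dist X Y) where
  Hom φ₁ φ₂ := DistHom φ₁ φ₂
  id φ :=
    { app := fun c a => 𝟙 (φ.hom c a)
      app_actCod := by intros; simp
      app_actDom := by intros; simp }
  comp f g :=
    { app := fun c a => f.app c a ≫ g.app c a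
      app_actCod := by
        intro c₁ c₂ a
        rw [← Category.assoc, f.app_actCod, Category.assoc, g.app_actCod, comp_whiskerRight,
          Category.assoc]
      app_actDom := by
        intro c a₁ a₂
        rw [← Category.assoc, f.app_actDom, Category.assoc, g.app_actDom,
          Bicategory.whiskerLeft_comp, Category.assoc] }
  id_comp f := by
    apply DistHom.ext; funext c a; exact Category.id_comp _
  comp_id f := by
    apply DistHom.ext; funext c a; exact Category.comp_id _
  assoc f g h := by
    apply DistHom.ext; funext c a; exact Category.assoc _ _ _

/-- The components of an isomorphism of distributors. -/
def isoApp {X Y : BCat.{s} B} {φ₁ φ₂ : Dist X Y} (i : φ₁ ≅ φ₂) (c : Y.carrier) (a : X.carrier) :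
    φ₁.hom c a ⟶ φ₂.hom c a :=
  DistHom.app i.hom c a

/-- The structural matrix `M` of an enriched category, as a distributor from it to itself; the
double action is the iterated `ι`. -/
def idDist (X : BCat.{s} B) : Dist X X where
  hom c a := X.M c a
  δ c c' a' a := (X.M a' a ◁ X.ι c c' a') ≫ X.ι c a' a
  unit c a := by
    rw [← Bicategory.whiskerLeft_comp_assoc, X.ι_ρ_target, ← whisker_exchange_assoc,
      X.ι_ρ_source]
    bicategory
  assoc c₁ c₂ c₃ a₁ a₂ a₃ := by
    have h₁ := X.ι_assoc c₁ c₂ a₃ a₂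
    rw [Iso.eq_inv_comp] at h₁
    have h₂ := X.ι_assoc c₁ c₂ c₃ a₃
    rw [Iso.eq_inv_comp] at h₂
    have h₃ := X.ι_assoc c₁ a₃ a₂ a₁
    calc
      _ = X.M a₂ a₁ ◁ (((X.M a₃ a₂ ◁ X.ι c₂ c₃ a₃) ▷ X.M c₁ c₂) ≫
            (X.ι c₂ a₃ a₂ ▷ X.M c₁ c₂) ≫ X.ι c₁ c₂ a₂) ≫ X.ι c₁ a₂ a₁ := by simp
      _ = X.M a₂ a₁ ◁ (((α_ (X.M a₃ a₂) (X.M c₃ a₃ ≫ X.M c₂ c₃) (X.M c₁ c₂)).hom ≫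
            (X.M a₃ a₂ ◁ ((X.ι c₂ c₃ a₃ ▷ X.M c₁ c₂) ≫ X.ι c₁ c₂ a₃)))) ≫
            (X.M a₂ a₁ ◁ X.ι c₁ a₃ a₂) ≫ X.ι c₁ a₂ a₁ := by
        rw [← h₁]; simp
      _ = _ := by
        rw [← h₂, h₃]
        simp only [Category.assoc, Bicategory.whiskerLeft_comp]
        rw [← whisker_exchange_assoc, ← whisker_exchange_assoc]
        simp

/-! ### Composition of distributors -/

/-- `(w, e)` is a cowedge of `ψ` and `φ` at `(d,a)`. -/
def IsCowedge {X Y Z : BCat.{s} B} (φ : Dist X Y) (ψ : Dist Y Z) (d : Z.carrier) (a : X.carrier)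
    (w : X.typ a ⟶ Z.typ d) (e : ∀ c : Y.carrier, φ.hom c a ≫ ψ.hom d c ⟶ w) : Prop :=
  ∀ c₁ c₂ : Y.carrier,
    (φ.actCod c₁ c₂ a ▷ ψ.hom d c₁) ≫ e c₁ =
      (α_ (φ.hom c₂ a) (Y.M c₁ c₂) (ψ.hom d c₁)).hom ≫ (φ.hom c₂ a ◁ ψ.actDom d c₁ c₂) ≫ e c₂

/-- `(w, e)` is a universal cowedge of `ψ` and `φ` at `(d,a)`, i.e. `w` is the coend
`∫^c ψ(d,c) φ(c,a)` over the middle enriched category. -/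
structure IsUniversalCowedge {X Y Z : BCat.{s} B} (φ : Dist X Y) (ψ : Dist Y Z) (d : Z.carrier)
    (a : X.carrier) (w : X.typ a ⟶ Z.typ d)
    (e : ∀ c : Y.carrier, φ.hom c a ≫ ψ.hom d c ⟶ w) : Prop where
  isCowedge : IsCowedge φ ψ d a w e
  existsUnique : ∀ (w' : X.typ a ⟶ Z.typ d) (e' : ∀ c : Y.carrier, φ.hom c a ≫ ψ.hom d c ⟶ w'),
    IsCowedge φ ψ d a w' e' → ∃! k : w ⟶ w', ∀ c, e c ≫ k = e' c

/-- `χ`, together with the 2-cells `e_c : ψ(d,c) φ(c,a) ⟹ χ(d,a)`, is a composite of `φ` and `ψ`: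
each `χ(d,a)` is the universal cowedge, and the double action of `χ` is the one induced by those
of `φ` and `ψ`. -/
structure IsComposite {X Y Z : BCat.{s} B} (φ : Dist X Y) (ψ : Dist Y Z) (χ : Dist X Z)
    (e : ∀ (d : Z.carrier) (a : X.carrier) (c : Y.carrier),
      φ.hom c a ≫ ψ.hom d c ⟶ χ.hom d a) : Prop where
  universal : ∀ (d : Z.carrier) (a : X.carrier), IsUniversalCowedge φ ψ d a (χ.hom d a) (e d a)
  e_δ : ∀ (d₁ d₂ : Z.carrier) (a₂ a₁ : X.carrier) (c : Y.carrier),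
    (X.M a₂ a₁ ◁ (e d₂ a₂ c ▷ Z.M d₁ d₂)) ≫ χ.δ d₁ d₂ a₂ a₁ =
      (X.M a₂ a₁ ◁ (α_ (φ.hom c a₂) (ψ.hom d₂ c) (Z.M d₁ d₂)).hom) ≫
        (α_ (X.M a₂ a₁) (φ.hom c a₂) (ψ.hom d₂ c ≫ Z.M d₁ d₂)).inv ≫
        (φ.actDom c a₂ a₁ ▷ (ψ.hom d₂ c ≫ Z.M d₁ d₂)) ≫
        (φ.hom c a₁ ◁ ψ.actCod d₁ d₂ c) ≫ e d₁ a₁ c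

/-- A choice of a composite for every composable pair of distributors. -/
structure DistComposition (B : Type u) [Bicategory.{w, v} B] where
  comp : ∀ {X Y Z : BCat.{s} B}, Dist X Y → Dist Y Z → Dist X Z
  e : ∀ {X Y Z : BCat.{s} B} (φ : Dist X Y) (ψ : Dist Y Z) (d : Z.carrier) (a : X.carrier)
    (c : Y.carrier), φ.hom c a ≫ ψ.hom d c ⟶ (comp φ ψ).hom d a
  isComposite : ∀ {X Y Z : BCat.{s} B} (φ : Dist X Y) (ψ : Dist Y Z),
    IsComposite φ ψ (comp φ ψ) (e φ ψ)

/-- Objects, 1-cells, identity 1-cells and composition of 1-cells of `Dist(B)`: the identity of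
`(M,A)` is the distributor `M`. -/
@[reducible]
def DistComposition.catStruct (K : DistComposition.{s} B) : CategoryStruct (BCat.{s} B) where
  Hom X Y := Dist X Y
  id X := idDist X
  comp φ ψ := K.comp φ ψ

/-! ### Bicategories with prescribed 1-cells and hom-categories -/

/-- The rest of the structure of a bicategory, when its objects, 1-cells, identity 1-cells,
composites of 1-cells and hom-categories are prescribed. The fields are those of Mathlib's
`Bicategory`. -/
structure BicategoryOn (Ob : Type u) (C : CategoryStruct.{v} Ob)
    (H : ∀ a b : Ob, Category.{w} (a ⟶ b)) where
  whiskerLeft : ∀ {a b c : Ob} (f : a ⟶ b) {g h : b ⟶ c}, (g ⟶ h) → (f ≫ g ⟶ f ≫ h)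
  whiskerRight : ∀ {a b c : Ob} {f g : a ⟶ b}, (f ⟶ g) → ∀ h : b ⟶ c, (f ≫ h ⟶ g ≫ h)
  associator : ∀ {a b c d : Ob} (f : a ⟶ b) (g : b ⟶ c) (h : c ⟶ d), (f ≫ g) ≫ h ≅ f ≫ g ≫ h
  leftUnitor : ∀ {a b : Ob} (f : a ⟶ b), 𝟙 a ≫ f ≅ f
  rightUnitor : ∀ {a b : Ob} (f : a ⟶ b), f ≫ 𝟙 b ≅ f
  whiskerLeft_id : ∀ {a b c : Ob} (f : a ⟶ b) (g : b ⟶ c), whiskerLeft f (𝟙 g) = 𝟙 (f ≫ g)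
  whiskerLeft_comp : ∀ {a b c : Ob} (f : a ⟶ b) {g h i : b ⟶ c} (η : g ⟶ h) (θ : h ⟶ i),
    whiskerLeft f (η ≫ θ) = whiskerLeft f η ≫ whiskerLeft f θ
  id_whiskerLeft : ∀ {a b : Ob} {f g : a ⟶ b} (η : f ⟶ g),
    whiskerLeft (𝟙 a) η = (leftUnitor f).hom ≫ η ≫ (leftUnitor g).inv
  comp_whiskerLeft : ∀ {a b c d : Ob} (f : a ⟶ b) (g : b ⟶ c) {h h' : c ⟶ d} (η : h ⟶ h'),
    whiskerLeft (f ≫ g) η =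
      (associator f g h).hom ≫ whiskerLeft f (whiskerLeft g η) ≫ (associator f g h').inv
  id_whiskerRight : ∀ {a b c : Ob} (f : a ⟶ b) (g : b ⟶ c), whiskerRight (𝟙 f) g = 𝟙 (f ≫ g)
  comp_whiskerRight : ∀ {a b c : Ob} {f g h : a ⟶ b} (η : f ⟶ g) (θ : g ⟶ h) (i : b ⟶ c),
    whiskerRight (η ≫ θ) i = whiskerRight η i ≫ whiskerRight θ i
  whiskerRight_id : ∀ {a b : Ob} {f g : a ⟶ b} (η : f ⟶ g),
    whiskerRight η (𝟙 b) = (rightUnitor f).hom ≫ η ≫ (rightUnitor g).inv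
  whiskerRight_comp : ∀ {a b c d : Ob} {f f' : a ⟶ b} (η : f ⟶ f') (g : b ⟶ c) (h : c ⟶ d),
    whiskerRight η (g ≫ h) =
      (associator f g h).inv ≫ whiskerRight (whiskerRight η g) h ≫ (associator f' g h).hom
  whisker_assoc : ∀ {a b c d : Ob} (f : a ⟶ b) {g g' : b ⟶ c} (η : g ⟶ g') (h : c ⟶ d),
    whiskerRight (whiskerLeft f η) h =
      (associator f g h).hom ≫ whiskerLeft f (whiskerRight η h) ≫ (associator f g' h).inv
  whisker_exchange : ∀ {a b c : Ob} {f g : a ⟶ b} {h i : b ⟶ c} (η : f ⟶ g) (θ : h ⟶ i),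
    whiskerLeft f θ ≫ whiskerRight η i = whiskerRight η h ≫ whiskerLeft g θ
  pentagon : ∀ {a b c d e : Ob} (f : a ⟶ b) (g : b ⟶ c) (h : c ⟶ d) (i : d ⟶ e),
    whiskerRight (associator f g h).hom i ≫
        (associator f (g ≫ h) i).hom ≫ whiskerLeft f (associator g h i).hom =
      (associator (f ≫ g) h i).hom ≫ (associator f g (h ≫ i)).hom
  triangle : ∀ {a b c : Ob} (f : a ⟶ b) (g : b ⟶ c),
    (associator f (𝟙 b) g).hom ≫ whiskerLeft f (leftUnitor g).hom =
      whiskerRight (rightUnitor f).hom g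

/-- The bicategory given by a `BicategoryOn`. -/
@[reducible]
def BicategoryOn.toBicategory {Ob : Type u} {C : CategoryStruct.{v} Ob}
    {H : ∀ a b : Ob, Category.{w} (a ⟶ b)} (S : BicategoryOn Ob C H) : Bicategory.{w, v} Ob where
  toCategoryStruct := C
  homCategory := H
  whiskerLeft f _ _ η := S.whiskerLeft f η
  whiskerRight η h := S.whiskerRight η h
  associator := S.associator
  leftUnitor := S.leftUnitor
  rightUnitor := S.rightUnitor
  whiskerLeft_id := S.whiskerLeft_id
  whiskerLeft_comp := S.whiskerLeft_comp
  id_whiskerLeft := S.id_whiskerLeft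
  comp_whiskerLeft := S.comp_whiskerLeft
  id_whiskerRight := S.id_whiskerRight
  comp_whiskerRight := S.comp_whiskerRight
  whiskerRight_id := S.whiskerRight_id
  whiskerRight_comp := S.whiskerRight_comp
  whisker_assoc := S.whisker_assoc
  whisker_exchange := S.whisker_exchange
  pentagon := S.pentagon
  triangle := S.triangle

/-- The full sub-bicategory of a bicategory on the objects satisfying `P`. -/
@[reducible]
def fullSubBicategory {Ob : Type u} (S : Bicategory.{w, v} Ob) (P : Ob → Prop) :
    Bicategory.{w, v} {X : Ob // P X} where
  Hom X Y := X.1 ⟶ Y.1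
  id X := 𝟙 X.1
  comp f g := f ≫ g
  homCategory X Y := S.homCategory X.1 Y.1
  whiskerLeft f _ _ η := S.whiskerLeft f η
  whiskerRight η h := S.whiskerRight η h
  associator f g h := S.associator f g h
  leftUnitor f := S.leftUnitor f
  rightUnitor f := S.rightUnitor f
  whiskerLeft_id f g := S.whiskerLeft_id f g
  whiskerLeft_comp f _ _ _ η θ := S.whiskerLeft_comp f η θ
  id_whiskerLeft η := S.id_whiskerLeft η
  comp_whiskerLeft f g _ _ η := S.comp_whiskerLeft f g η
  id_whiskerRight f g := S.id_whiskerRight f g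
  comp_whiskerRight η θ i := S.comp_whiskerRight η θ i
  whiskerRight_id η := S.whiskerRight_id η
  whiskerRight_comp η g h := S.whiskerRight_comp η g h
  whisker_assoc f _ _ η h := S.whisker_assoc f η h
  whisker_exchange η θ := S.whisker_exchange η θ
  pentagon f g h i := S.pentagon f g h i
  triangle f g := S.triangle f g

/-- A bicategory structure on enriched categories, distributors and morphisms of distributors,
for the choice `K` of composites. -/
abbrev DistBicategoryOn (K : DistComposition.{s} B) :=
  BicategoryOn (BCat.{s} B) K.catStruct (fun X Y => distCategory X Y)

/-- The horizontal composition and the structural isomorphisms are the ones induced by the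
universal property of the coends. The horizontal composite of `f` and `g` being
`(f ▷ ψ₁) ≫ (φ₂ ◁ g)`, the first two fields say that it is induced by the `g_{dc} * f_{ca}`. -/
structure DistBicategoryOn.IsCanonical {K : DistComposition.{s} B} (S : DistBicategoryOn K) :
    Prop where
  whiskerLeft_app : ∀ {X Y Z : BCat.{s} B} (φ : Dist X Y) {ψ₁ ψ₂ : Dist Y Z} (g : DistHom ψ₁ ψ₂)
    (d : Z.carrier) (a : X.carrier) (c : Y.carrier),
    K.e φ ψ₁ d a c ≫ DistHom.app (S.whiskerLeft φ g) d a =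
      (φ.hom c a ◁ g.app d c) ≫ K.e φ ψ₂ d a c
  whiskerRight_app : ∀ {X Y Z : BCat.{s} B} {φ₁ φ₂ : Dist X Y} (f : DistHom φ₁ φ₂) (ψ : Dist Y Z)
    (d : Z.carrier) (a : X.carrier) (c : Y.carrier),
    K.e φ₁ ψ d a c ≫ DistHom.app (S.whiskerRight f ψ) d a =
      (f.app c a ▷ ψ.hom d c) ≫ K.e φ₂ ψ d a c
  associator_app : ∀ {X Y Z W : BCat.{s} B} (φ : Dist X Y) (ψ : Dist Y Z) (χ : Dist Z W)
    (x : W.carrier) (a : X.carrier) (c : Y.carrier) (d : Z.carrier),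
    (K.e φ ψ d a c ▷ χ.hom x d) ≫ K.e (K.comp φ ψ) χ x a d ≫
        isoApp (S.associator φ ψ χ) x a =
      (α_ (φ.hom c a) (ψ.hom d c) (χ.hom x d)).hom ≫ (φ.hom c a ◁ K.e ψ χ x c d) ≫
        K.e φ (K.comp ψ χ) x a c
  leftUnitor_app : ∀ {X Y : BCat.{s} B} (φ : Dist X Y) (c : Y.carrier) (a a' : X.carrier),
    K.e (idDist X) φ c a a' ≫ isoApp (S.leftUnitor φ) c a = φ.actDom c a' a
  rightUnitor_app : ∀ {X Y : BCat.{s} B} (φ : Dist X Y) (c c' : Y.carrier) (a : X.carrier),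
    K.e φ (idDist Y) c a c' ≫ isoApp (S.rightUnitor φ) c a = φ.actCod c c' a

/-! ### Symmetric enriched categories -/

/-- An enriched category is symmetric: `M(a,b) = M(b,a)°`, `ρ_a° = ρ_a` and `ι_{abc}° = ι_{cba}`,
the equalities of 2-cells being taken along the equalities of 1-cells and the structural 2-cells
of the involution. -/
structure IsSymmetric (I : Involution B) (X : BCat.{s} B) : Prop where
  M_eq : ∀ a b : X.carrier, X.M a b = I.inv (X.M b a)
  ρ_eq : ∀ a : X.carrier, (I.invId (X.typ a)).hom ≫ I.inv₂ (X.ρ a) = X.ρ a ≫ eqToHom (M_eq a a)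
  ι_eq : ∀ a b c : X.carrier,
    (I.invComp (X.M b c) (X.M a b)).hom ≫ I.inv₂ (X.ι a b c) =
      eqToHom (congrArg₂ (· ≫ ·) (M_eq b a).symm (M_eq c b).symm) ≫ X.ι c b a ≫
        eqToHom (M_eq c a)

/-- `φ'` is the distributor `φ°`, i.e. `φ°(a,c) = φ(c,a)°` and `δ^{φ°} = (δ^φ)°`. -/
structure IsOpposite (I : Involution B) {X Y : BCat.{s} B} (hX : IsSymmetric I X)
    (hY : IsSymmetric I Y) (φ : Dist X Y) (φ' : Dist Y X) : Prop where
  hom_eq : ∀ (a : X.carrier) (c : Y.carrier), φ'.hom a c = I.inv (φ.hom c a)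
  δ_eq : ∀ (a₁ a₂ : X.carrier) (c₂ c₁ : Y.carrier),
    φ'.δ a₁ a₂ c₂ c₁ ≫ eqToHom (hom_eq a₁ c₁) =
      eqToHom (congrArg₂ (· ≫ ·) (hY.M_eq c₂ c₁)
          (congrArg₂ (· ≫ ·) (hom_eq a₂ c₂) (hX.M_eq a₁ a₂))) ≫
        I.invComp₃ (X.M a₂ a₁) (φ.hom c₂ a₂) (Y.M c₁ c₂) ≫ I.inv₂ (φ.δ c₁ c₂ a₂ a₁)

/-- The objects of `Dist_s(B)`: the symmetric enriched categories. -/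
@[nolint unusedArguments]
def DistSym {K : DistComposition.{s} B} (_S : DistBicategoryOn K) (I : Involution B) :=
  {X : BCat.{s} B // IsSymmetric I X}

/-- `Dist_s(B)`, the full sub-bicategory of `Dist(B)` on the symmetric enriched categories. -/
instance distSymBicategory {K : DistComposition.{s} B} (S : DistBicategoryOn K)
    (I : Involution B) : Bicategory (DistSym S I) :=
  fullSubBicategory S.toBicategory (IsSymmetric I)

/-- The involution `J` of `Dist_s(B)` is the one induced by the involution `I` of `B`: it sends a
distributor `φ` to `φ°` and a morphism `f` to `f°`, where `(f°)_{ac} = (f_{ca})°`, and its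
structural 2-cells are induced by those of `I`. -/
structure IsInducedInvolution {K : DistComposition.{s} B} (S : DistBicategoryOn K)
    (I : Involution B) (J : Involution (DistSym S I)) : Prop where
  inv_eq : ∀ (X Y : DistSym S I) (φ : Dist X.1 Y.1),
    IsOpposite I X.2 Y.2 φ (J.inv (x := X) (y := Y) φ)
  inv₂_eq : ∀ (X Y : DistSym S I) (φ₁ φ₂ : Dist X.1 Y.1) (f : DistHom φ₁ φ₂)
    (a : X.1.carrier) (c : Y.1.carrier),
    DistHom.app (J.inv₂ (x := X) (y := Y) (f := φ₁) (g := φ₂) f) a c ≫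
        eqToHom ((inv_eq X Y φ₂).hom_eq a c) =
      eqToHom ((inv_eq X Y φ₁).hom_eq a c) ≫ I.inv₂ (f.app c a)
  invId_eq : ∀ (X : DistSym S I) (a a' : X.1.carrier),
    isoApp (J.invId X) a a' ≫ eqToHom ((inv_eq X X (idDist X.1)).hom_eq a a') =
      eqToHom (X.2.M_eq a a')
  invComp_eq : ∀ (X Y Z : DistSym S I) (φ : Dist X.1 Y.1) (ψ : Dist Y.1 Z.1)
    (a : X.1.carrier) (d : Z.1.carrier) (c : Y.1.carrier),
    K.e (J.inv (x := Y) (y := Z) ψ) (J.inv (x := X) (y := Y) φ) a d c ≫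
        isoApp (J.invComp (x := X) (y := Y) (z := Z) φ ψ) a d ≫
        eqToHom ((inv_eq X Z (K.comp φ ψ)).hom_eq a d) =
      eqToHom (congrArg₂ (· ≫ ·) ((inv_eq Y Z ψ).hom_eq c d) ((inv_eq X Y φ).hom_eq a c)) ≫
        (I.invComp (φ.hom c a) (ψ.hom d c)).hom ≫ I.inv₂ (K.e φ ψ d a c)

end EnrichedBicat

/-! A distributor is a bimodule: its double action amounts to two unital, associative one-sided
actions that commute (`Dist.comm`, `Dist.ofActions`), and a composite is a tensor product over the
middle enriched category. As for modules, everything rests on the right exactness of the tensor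
product. Closedness gives whiskering by a fixed 1-cell a right adjoint, so whiskering preserves the
universal families that define the coends (`IsUniversalFamily.whiskerLeft`,
`IsUniversalFamily.whiskerRight`). Local cocompleteness supplies these coends as coequalizers of
coproducts, and the outer actions descend to them (`exists_isComposite`).

Consequently a 2-cell out of an iterated composite, whiskered or not, is determined by its values on
the generators `e`, and a morphism of distributors out of a composite is the same thing as a
bilinear family (`IsBilinear`, `IsComposite.exists_desc`). The associator arises by two successive
descents, one for each middle variable. The unitors come from the fact that an action of an enriched
category is a split coequalizer, the unit `ρ` giving the splitting, together with uniqueness of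
composites (`IsComposite.exists_iso`). On generators each bicategory axiom becomes coherence or
interchange in `B`, or the balancing relation of the coend.

For the last claim, an involution is a self-inverse isomorphism between hom-categories, so it too
preserves universal families. Symmetry turns the image of an action on one side into an action on
the other side, and `isComposite_opp` shows that the opposite of a composite is a composite of the
opposites. Uniqueness then produces the structural 2-cells, whose laws reduce on generators to those
of the given involution. That the square is the identity is a strict equality, obtained through
`Dist.eq_of_hom`. -/

namespace EnrichedBicat

variable {B : Type u} [Bicategory.{w, v} B]

/-! ### Universal coequalizing families -/

section Families

variable {C : Type*} [Category C] {I J : Type*} {P : I → C} {Q : J → C} {σ τ : J → I}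

/-- The family `e` is universal among the families out of `P` that coequalize `l` and `r`. -/
structure IsUniversalFamily (l : ∀ j, Q j ⟶ P (σ j)) (r : ∀ j, Q j ⟶ P (τ j)) {w : C}
    (e : ∀ i, P i ⟶ w) : Prop where
  condition : ∀ j, l j ≫ e (σ j) = r j ≫ e (τ j)
  existsUnique : ∀ (w' : C) (e' : ∀ i, P i ⟶ w'), (∀ j, l j ≫ e' (σ j) = r j ≫ e' (τ j)) →
    ∃! k : w ⟶ w', ∀ i, e i ≫ k = e' i

theorem IsUniversalFamily.hom_ext {l : ∀ j, Q j ⟶ P (σ j)} {r : ∀ j, Q j ⟶ P (τ j)} {w : C}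
    {e : ∀ i, P i ⟶ w} (h : IsUniversalFamily l r e) {w' : C} {f g : w ⟶ w'}
    (hfg : ∀ i, e i ≫ f = e i ≫ g) : f = g :=
  (h.existsUnique w' (fun i => e i ≫ g)
    (fun j => by rw [← Category.assoc, h.condition, Category.assoc])).unique hfg (fun _ => rfl)

theorem exists_isUniversalFamily {C : Type u} [Category.{w} C] {I J : Type s} {P : I → C}
    {Q : J → C} {σ τ : J → I} [Limits.HasColimitsOfSize.{s, s} C]
    (l : ∀ j, Q j ⟶ P (σ j)) (r : ∀ j, Q j ⟶ P (τ j)) :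
    ∃ (w : C) (e : ∀ i, P i ⟶ w), IsUniversalFamily l r e := by
  -- Coequalizers are indexed by a category in universe `0`, whereas cocompleteness is given in size
  -- `s`.
  have : Limits.HasColimitsOfSize.{0, 0} C := Limits.hasColimitsOfSizeShrink.{0, 0, s, s} C
  let L : (∐ Q) ⟶ ∐ P := Limits.Sigma.desc fun j => l j ≫ Limits.Sigma.ι P (σ j)
  let R : (∐ Q) ⟶ ∐ P := Limits.Sigma.desc fun j => r j ≫ Limits.Sigma.ι P (τ j)
  refine ⟨Limits.coequalizer L R, fun i => Limits.Sigma.ι P i ≫ Limits.coequalizer.π L R,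
    fun j => ?_, fun w' e' he' => ?_⟩
  · have := Limits.Sigma.ι Q j ≫= Limits.coequalizer.condition L R
    simpa [L, R] using this
  · refine ⟨Limits.coequalizer.desc (Limits.Sigma.desc e') ?_, fun i => ?_, fun k hk => ?_⟩
    · refine Limits.Sigma.hom_ext _ _ fun j => ?_
      simpa [L, R] using he' j
    · simp
    · refine Limits.coequalizer.hom_ext (Limits.Sigma.hom_ext _ _ fun i => ?_)
      simpa using hk i

end Families

/-! ### Whiskering as a left adjoint. -/

section Whiskering

variable {I J : Type*} {σ τ : J → I} {x y z : B}

/-- The universal property of the right Kan extension is spelled out as an adjunction: 2-cells `f ≫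
h ⟶ g` transpose uniquely to 2-cells `h ⟶ t`. -/
theorem IsClosedBicategory.exists_ranEquiv (hB : IsClosedBicategory B) (f : x ⟶ y) (g : x ⟶ z) :
    ∃ (t : y ⟶ z) (c : f ≫ t ⟶ g), ∀ (h : y ⟶ z) (α : f ≫ h ⟶ g), ∃! β : h ⟶ t, f ◁ β ≫ c = α := by
  obtain ⟨t, ⟨ht⟩⟩ := hB.exists_rightKanExtension f g
  refine ⟨t.left, t.hom, fun h α => ⟨ht.lift (CostructuredArrow.mk α), ?_, fun β hβ => ?_⟩⟩
  · exact ht.fac (CostructuredArrow.mk α)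
  · refine ht.hom_ext ?_
    exact hβ.trans (ht.fac (CostructuredArrow.mk α)).symm

theorem IsClosedBicategory.exists_riftEquiv (hB : IsClosedBicategory B) (f : y ⟶ x) (g : z ⟶ x) :
    ∃ (t : z ⟶ y) (c : t ≫ f ⟶ g), ∀ (h : z ⟶ y) (α : h ≫ f ⟶ g), ∃! β : h ⟶ t, β ▷ f ≫ c = α := by
  obtain ⟨t, ⟨ht⟩⟩ := hB.exists_rightKanLift f g
  refine ⟨t.left, t.hom, fun h α => ⟨ht.lift (CostructuredArrow.mk α), ?_, fun β hβ => ?_⟩⟩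
  · exact ht.fac (CostructuredArrow.mk α)
  · refine ht.hom_ext ?_
    exact hβ.trans (ht.fac (CostructuredArrow.mk α)).symm

/-- Whiskering on the left preserves universal families. -/
theorem IsUniversalFamily.whiskerLeft (hB : IsClosedBicategory B) {P : I → (y ⟶ z)}
    {Q : J → (y ⟶ z)} {l : ∀ j, Q j ⟶ P (σ j)} {r : ∀ j, Q j ⟶ P (τ j)} {w : y ⟶ z}
    {e : ∀ i, P i ⟶ w} (h : IsUniversalFamily l r e) (f : x ⟶ y) :
    IsUniversalFamily (P := fun i => f ≫ P i) (Q := fun j => f ≫ Q j) (σ := σ) (τ := τ)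
      (fun j => f ◁ l j) (fun j => f ◁ r j) (fun i => f ◁ e i) := by
  refine ⟨fun j => ?_, fun w' e' he' => ?_⟩
  · rw [← Bicategory.whiskerLeft_comp, h.condition, Bicategory.whiskerLeft_comp]
  · obtain ⟨t, c, ht⟩ := hB.exists_ranEquiv f w'
    choose b hb using fun h α => (ht h α).exists
    have ext : ∀ {h : y ⟶ z} {β β' : h ⟶ t}, f ◁ β ≫ c = f ◁ β' ≫ c → β = β' :=
      fun {h β β'} hβ => (ht h _).unique hβ rfl
    obtain ⟨k, hk, -⟩ := h.existsUnique t (fun i => b _ (e' i)) (fun j => ext (by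
      simp only [Bicategory.whiskerLeft_comp, Category.assoc, hb, he']))
    refine ⟨f ◁ k ≫ c, fun i => ?_, fun k' hk' => ?_⟩
    · rw [← Category.assoc, ← Bicategory.whiskerLeft_comp, hk, hb]
    · suffices hkk : b _ k' = k by rw [← hb _ k', hkk]
      refine h.hom_ext fun i => ext ?_
      rw [hk, hb, Bicategory.whiskerLeft_comp, Category.assoc, hb, hk']

/-- Whiskering on the right preserves universal families. -/
theorem IsUniversalFamily.whiskerRight (hB : IsClosedBicategory B) {P : I → (x ⟶ y)}
    {Q : J → (x ⟶ y)} {l : ∀ j, Q j ⟶ P (σ j)} {r : ∀ j, Q j ⟶ P (τ j)} {w : x ⟶ y}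
    {e : ∀ i, P i ⟶ w} (h : IsUniversalFamily l r e) (f : y ⟶ z) :
    IsUniversalFamily (P := fun i => P i ≫ f) (Q := fun j => Q j ≫ f) (σ := σ) (τ := τ)
      (fun j => l j ▷ f) (fun j => r j ▷ f) (fun i => e i ▷ f) := by
  refine ⟨fun j => ?_, fun w' e' he' => ?_⟩
  · rw [← comp_whiskerRight, h.condition, comp_whiskerRight]
  · obtain ⟨t, c, ht⟩ := hB.exists_riftEquiv f w'
    choose b hb using fun h α => (ht h α).exists
    have ext : ∀ {h : x ⟶ y} {β β' : h ⟶ t}, β ▷ f ≫ c = β' ▷ f ≫ c → β = β' :=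
      fun {h β β'} hβ => (ht h _).unique hβ rfl
    obtain ⟨k, hk, -⟩ := h.existsUnique t (fun i => b _ (e' i)) (fun j => ext (by
      simp only [comp_whiskerRight, Category.assoc, hb, he']))
    refine ⟨k ▷ f ≫ c, fun i => ?_, fun k' hk' => ?_⟩
    · rw [← Category.assoc, ← comp_whiskerRight, hk, hb]
    · suffices hkk : b _ k' = k by rw [← hb _ k', hkk]
      refine h.hom_ext fun i => ext ?_
      rw [hk, hb, comp_whiskerRight, Category.assoc, hb, hk']

end Whiskering

/-! ### Distributors as bimodules: one-sided actions. -/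

namespace Dist
variable {X Y : BCat.{s} B} (φ : Dist X Y)

/-- The associativity of the double action, evaluated on generalized elements of the matrices. -/
theorem assoc_comp (c₁ c₂ c₃ : Y.carrier) (a₁ a₂ a₃ : X.carrier)
    {f : X.typ a₁ ⟶ X.typ a₂} (p : f ⟶ X.M a₂ a₁) {g : X.typ a₂ ⟶ X.typ a₃} (q : g ⟶ X.M a₃ a₂)
    {h : Y.typ c₃ ⟶ Y.typ c₂} (r : h ⟶ Y.M c₂ c₃) {k : Y.typ c₂ ⟶ Y.typ c₁} (t : k ⟶ Y.M c₁ c₂) :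
    f ◁ ((q ▷ (φ.hom c₃ a₃ ≫ h) ≫ X.M a₃ a₂ ◁ φ.hom c₃ a₃ ◁ r ≫ φ.δ c₂ c₃ a₃ a₂) ▷ k) ≫
        f ◁ φ.hom c₂ a₂ ◁ t ≫ p ▷ (φ.hom c₂ a₂ ≫ Y.M c₁ c₂) ≫ φ.δ c₁ c₂ a₂ a₁ =
      f ◁ ((α_ g (φ.hom c₃ a₃ ≫ h) k).hom ≫ g ◁ (α_ (φ.hom c₃ a₃) h k).hom) ≫
        (α_ f g (φ.hom c₃ a₃ ≫ h ≫ k)).inv ≫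
        (f ◁ q ≫ p ▷ X.M a₃ a₂ ≫ X.ι a₃ a₂ a₁) ▷ (φ.hom c₃ a₃ ≫ h ≫ k) ≫
        X.M a₃ a₁ ◁ φ.hom c₃ a₃ ◁ (h ◁ t ≫ r ▷ Y.M c₁ c₂ ≫ Y.ι c₁ c₂ c₃) ≫ φ.δ c₁ c₃ a₃ a₁ := by
  calc
    _ = f ◁ ((q ▷ (φ.hom c₃ a₃ ≫ h) ≫ X.M a₃ a₂ ◁ φ.hom c₃ a₃ ◁ r) ▷ k) ≫
          f ◁ (φ.δ c₂ c₃ a₃ a₂ ▷ k ≫ φ.hom c₂ a₂ ◁ t) ≫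
          p ▷ (φ.hom c₂ a₂ ≫ Y.M c₁ c₂) ≫ φ.δ c₁ c₂ a₂ a₁ := by
      simp only [comp_whiskerRight, Bicategory.whiskerLeft_comp, Category.assoc]
    _ = f ◁ ((q ▷ (φ.hom c₃ a₃ ≫ h) ≫ X.M a₃ a₂ ◁ φ.hom c₃ a₃ ◁ r) ▷ k) ≫
          f ◁ ((X.M a₃ a₂ ≫ φ.hom c₃ a₃ ≫ Y.M c₂ c₃) ◁ t) ≫ p ▷ _ ≫
          X.M a₂ a₁ ◁ (φ.δ c₂ c₃ a₃ a₂ ▷ Y.M c₁ c₂) ≫ φ.δ c₁ c₂ a₂ a₁ := by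
      -- Interchange slides `t` and `p` in front of the inner `δ`, so that the left side of
      -- `φ.assoc` appears at the end.
      rw [← whisker_exchange (φ.δ c₂ c₃ a₃ a₂) t, Bicategory.whiskerLeft_comp, Category.assoc,
        whisker_exchange_assoc p (φ.δ c₂ c₃ a₃ a₂ ▷ Y.M c₁ c₂)]
    _ = f ◁ ((α_ g (φ.hom c₃ a₃ ≫ h) k).hom ≫ g ◁ (α_ (φ.hom c₃ a₃) h k).hom) ≫
        (α_ f g (φ.hom c₃ a₃ ≫ h ≫ k)).inv ≫
        (f ◁ q) ▷ (φ.hom c₃ a₃ ≫ h ≫ k) ≫ (f ≫ X.M a₃ a₂) ◁ (φ.hom c₃ a₃ ◁ (r ▷ k)) ≫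
        ((f ≫ X.M a₃ a₂) ◁ φ.hom c₃ a₃ ◁ (Y.M c₂ c₃ ◁ t) ≫
          (p ▷ X.M a₃ a₂) ▷ (φ.hom c₃ a₃ ≫ Y.M c₂ c₃ ≫ Y.M c₁ c₂)) ≫
        (X.ι a₃ a₂ a₁ ▷ (φ.hom c₃ a₃ ≫ Y.M c₂ c₃ ≫ Y.M c₁ c₂)) ≫
        (X.M a₃ a₁ ◁ φ.hom c₃ a₃ ◁ Y.ι c₁ c₂ c₃) ≫ φ.δ c₁ c₃ a₃ a₁ := by
      rw [φ.assoc]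
      bicategory
    _ = _ := by
      rw [whisker_exchange_assoc r t]
      simp only [comp_whiskerRight, Bicategory.whiskerLeft_comp, Category.assoc,
        ← whisker_exchange_assoc (f ◁ q), ← whisker_exchange_assoc (p ▷ X.M a₃ a₂),
        ← whisker_exchange_assoc (X.ι a₃ a₂ a₁)]

/-- Associativity is evaluated with units in the inner domain slot and the outer codomain slot. The
inner `δ` becomes the codomain action, the outer one the domain action, and the unit laws of `ι`
reduce the other side to a single `δ`. -/
theorem whiskerLeft_actCod_comp_actDom (c c' : Y.carrier) (a' a : X.carrier) :
    X.M a' a ◁ φ.actCod c c' a' ≫ φ.actDom c a' a = φ.δ c c' a' a := by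
  have h := φ.assoc_comp c c c' a a' a' (𝟙 (X.M a' a)) (X.ρ a') (𝟙 (Y.M c c')) (Y.ρ c)
  simp only [Bicategory.whiskerLeft_id, id_whiskerRight, Category.id_comp, X.ι_ρ_target,
    Y.ι_ρ_target] at h
  rw [← cancel_epi (X.M a' a ◁ ((λ_ (φ.hom c' a' ≫ Y.M c c')).hom ▷ 𝟙 _ ≫ (ρ_ _).hom))]
  refine Eq.trans ?_ (h.trans ?_)
  · dsimp only [actCod, actDom]
    bicategory
  · bicategory

/-- The units now occupy the two complementary slots, which exchanges the order of the actions. -/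
theorem actDom_whiskerRight_comp_actCod (c c' : Y.carrier) (a' a : X.carrier) :
    φ.actDom c' a' a ▷ Y.M c c' ≫ φ.actCod c c' a = (α_ _ _ _).hom ≫ φ.δ c c' a' a := by
  have h := φ.assoc_comp c c' c' a a a' (X.ρ a) (𝟙 (X.M a' a)) (Y.ρ c') (𝟙 (Y.M c c'))
  simp only [Bicategory.whiskerLeft_id, id_whiskerRight, Category.id_comp, X.ι_ρ_source,
    Y.ι_ρ_source] at h
  rw [← cancel_epi ((λ_ _).hom ≫ (X.M a' a ◁ (ρ_ (φ.hom c' a')).hom) ▷ Y.M c c')]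
  refine Eq.trans ?_ (h.trans ?_)
  · dsimp only [actCod, actDom]
    bicategory
  · bicategory

theorem actCod_assoc (c₁ c₂ c₃ : Y.carrier) (a : X.carrier) :
    φ.actCod c₂ c₃ a ▷ Y.M c₁ c₂ ≫ φ.actCod c₁ c₂ a =
      (α_ _ _ _).hom ≫ φ.hom c₃ a ◁ Y.ι c₁ c₂ c₃ ≫ φ.actCod c₁ c₃ a := by
  have h := φ.assoc_comp c₁ c₂ c₃ a a a (X.ρ a) (X.ρ a) (𝟙 _) (𝟙 _)
  simp only [Bicategory.whiskerLeft_id, id_whiskerRight, Category.id_comp, X.ι_ρ_source] at h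
  -- The two units in the domain slots have merged into one `ρ`. It is moved past `ι` to sit next to
  -- `δ`, where it forms the codomain action.
  rw [leftUnitor_naturality, comp_whiskerRight (λ_ (𝟙 _)).hom, Category.assoc, ← whisker_exchange_assoc] at h
  rw [← cancel_epi ((λ_ _).hom ≫ (λ_ (φ.hom c₃ a ≫ Y.M c₂ c₃)).hom ▷ Y.M c₁ c₂)]
  refine Eq.trans ?_ (h.trans ?_)
  · dsimp only [actCod, actDom]
    bicategory
  · dsimp only [actCod, actDom]
    bicategory

theorem actDom_assoc (c : Y.carrier) (a₁ a₂ a₃ : X.carrier) :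
    X.M a₂ a₁ ◁ φ.actDom c a₃ a₂ ≫ φ.actDom c a₂ a₁ =
      (α_ _ _ _).inv ≫ X.ι a₃ a₂ a₁ ▷ φ.hom c a₃ ≫ φ.actDom c a₃ a₁ := by
  have h := φ.assoc_comp c c c a₁ a₂ a₃ (𝟙 _) (𝟙 _) (Y.ρ c) (Y.ρ c)
  simp only [Bicategory.whiskerLeft_id, id_whiskerRight, Category.id_comp, Y.ι_ρ_source] at h
  rw [← cancel_epi (X.M a₂ a₁ ◁ ((ρ_ _).hom ≫ X.M a₃ a₂ ◁ (ρ_ (φ.hom c a₃)).hom))]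
  refine Eq.trans ?_ (h.trans ?_)
  · dsimp only [actCod, actDom]
    bicategory
  · dsimp only [actCod, actDom]
    bicategory

theorem actCod_unit (c : Y.carrier) (a : X.carrier) :
    φ.hom c a ◁ Y.ρ c ≫ φ.actCod c c a = (ρ_ _).hom := by
  have := φ.unit c a
  rw [← whisker_exchange_assoc] at this
  rw [← cancel_epi ((λ_ (φ.hom c a ≫ 𝟙 _)).hom)]
  refine Eq.trans ?_ (this.trans ?_)
  · dsimp only [actCod, actDom]
    bicategory
  · bicategory

theorem actDom_unit (c : Y.carrier) (a : X.carrier) :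
    X.ρ a ▷ φ.hom c a ≫ φ.actDom c a a = (λ_ _).hom := by
  have := φ.unit c a
  rw [← cancel_epi (𝟙 (X.typ a) ◁ (ρ_ (φ.hom c a)).hom)]
  refine Eq.trans ?_ (this.trans ?_)
  · dsimp only [actCod, actDom]
    bicategory
  · bicategory

end Dist

namespace Dist

/-- Both orders of acting compute the double action `δ`. This commutation is what lets the outer
actions descend to a coend. -/
theorem comm {X Y : BCat.{s} B} (φ : Dist X Y) (c c' : Y.carrier) (a' a : X.carrier) :
    X.M a' a ◁ φ.actCod c c' a' ≫ φ.actDom c a' a =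
      (α_ _ _ _).inv ≫ φ.actDom c' a' a ▷ Y.M c c' ≫ φ.actCod c c' a := by
  rw [actDom_whiskerRight_comp_actCod, whiskerLeft_actCod_comp_actDom, Iso.inv_hom_id_assoc]

/-- A distributor given by its two one-sided actions. -/
@[reducible]
def ofActions {X Y : BCat.{s} B} (hom : ∀ (c : Y.carrier) (a : X.carrier), X.typ a ⟶ Y.typ c)
    (cod : ∀ (c c' : Y.carrier) (a : X.carrier), hom c' a ≫ Y.M c c' ⟶ hom c a)
    (dom : ∀ (c : Y.carrier) (a' a : X.carrier), X.M a' a ≫ hom c a' ⟶ hom c a)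
    (cod_unit : ∀ c a, hom c a ◁ Y.ρ c ≫ cod c c a = (ρ_ _).hom)
    (dom_unit : ∀ c a, X.ρ a ▷ hom c a ≫ dom c a a = (λ_ _).hom)
    (cod_assoc : ∀ c₁ c₂ c₃ a, cod c₂ c₃ a ▷ Y.M c₁ c₂ ≫ cod c₁ c₂ a =
      (α_ _ _ _).hom ≫ hom c₃ a ◁ Y.ι c₁ c₂ c₃ ≫ cod c₁ c₃ a)
    (dom_assoc : ∀ c a₁ a₂ a₃, X.M a₂ a₁ ◁ dom c a₃ a₂ ≫ dom c a₂ a₁ =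
      (α_ _ _ _).inv ≫ X.ι a₃ a₂ a₁ ▷ hom c a₃ ≫ dom c a₃ a₁)
    (comm : ∀ c c' a' a, X.M a' a ◁ cod c c' a' ≫ dom c a' a =
      (α_ _ _ _).inv ≫ dom c' a' a ▷ Y.M c c' ≫ cod c c' a) : Dist X Y where
  hom := hom
  δ c c' a' a := X.M a' a ◁ cod c c' a' ≫ dom c a' a
  unit c a := by
    rw [← Bicategory.whiskerLeft_comp_assoc, cod_unit, ← whisker_exchange_assoc, dom_unit]
    bicategory
  assoc c₁ c₂ c₃ a₁ a₂ a₃ := by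
    -- Commutation moves the inner domain action past the outer codomain action; after that the two
    -- associativity laws apply separately.
    have h : dom c₂ a₃ a₂ ▷ Y.M c₁ c₂ ≫ cod c₁ c₂ a₂ =
        (α_ _ _ _).hom ≫ X.M a₃ a₂ ◁ cod c₁ c₂ a₃ ≫ dom c₁ a₃ a₂ := by
      rw [comm, Iso.hom_inv_id_assoc]
    calc
      _ = X.M a₂ a₁ ◁ ((X.M a₃ a₂ ◁ cod c₂ c₃ a₃) ▷ Y.M c₁ c₂ ≫
            dom c₂ a₃ a₂ ▷ Y.M c₁ c₂ ≫ cod c₁ c₂ a₂) ≫ dom c₁ a₂ a₁ := by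
        simp only [Bicategory.whiskerLeft_comp, comp_whiskerRight, Category.assoc]
      _ = X.M a₂ a₁ ◁ ((α_ _ _ _).hom ≫ X.M a₃ a₂ ◁ (cod c₂ c₃ a₃ ▷ Y.M c₁ c₂ ≫
            cod c₁ c₂ a₃)) ≫ X.M a₂ a₁ ◁ dom c₁ a₃ a₂ ≫ dom c₁ a₂ a₁ := by
        rw [h]
        simp
      _ = _ := by
        rw [cod_assoc, dom_assoc]
        simp only [Bicategory.whiskerLeft_comp, Category.assoc]
        rw [← whisker_exchange_assoc, ← whisker_exchange_assoc]
        simp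

section ofActions

variable {X Y : BCat.{s} B} {hom : ∀ (c : Y.carrier) (a : X.carrier), X.typ a ⟶ Y.typ c}
    {cod : ∀ (c c' : Y.carrier) (a : X.carrier), hom c' a ≫ Y.M c c' ⟶ hom c a}
    {dom : ∀ (c : Y.carrier) (a' a : X.carrier), X.M a' a ≫ hom c a' ⟶ hom c a}
    (cod_unit : ∀ c a, hom c a ◁ Y.ρ c ≫ cod c c a = (ρ_ _).hom)
    (dom_unit : ∀ c a, X.ρ a ▷ hom c a ≫ dom c a a = (λ_ _).hom)
    (cod_assoc : ∀ c₁ c₂ c₃ a, cod c₂ c₃ a ▷ Y.M c₁ c₂ ≫ cod c₁ c₂ a =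
      (α_ _ _ _).hom ≫ hom c₃ a ◁ Y.ι c₁ c₂ c₃ ≫ cod c₁ c₃ a)
    (dom_assoc : ∀ c a₁ a₂ a₃, X.M a₂ a₁ ◁ dom c a₃ a₂ ≫ dom c a₂ a₁ =
      (α_ _ _ _).inv ≫ X.ι a₃ a₂ a₁ ▷ hom c a₃ ≫ dom c a₃ a₁)
    (comm : ∀ c c' a' a, X.M a' a ◁ cod c c' a' ≫ dom c a' a =
      (α_ _ _ _).inv ≫ dom c' a' a ▷ Y.M c c' ≫ cod c c' a)

@[simp]
theorem ofActions_actCod :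
    (ofActions hom cod dom cod_unit dom_unit cod_assoc dom_assoc comm).actCod = cod := by
  funext c c' a
  dsimp only [actCod, ofActions]
  rw [← whisker_exchange_assoc, dom_unit]
  simp

@[simp]
theorem ofActions_actDom :
    (ofActions hom cod dom cod_unit dom_unit cod_assoc dom_assoc comm).actDom = dom := by
  funext c a' a
  dsimp only [actDom, ofActions]
  rw [← Bicategory.whiskerLeft_comp_assoc, Category.assoc, cod_unit]
  simp

end ofActions

end Dist

theorem idDist_actCod (X : BCat.{s} B) (c c' a : X.carrier) :
    (idDist X).actCod c c' a = X.ι c c' a := by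
  dsimp only [Dist.actCod, idDist]
  rw [← whisker_exchange_assoc, X.ι_ρ_source]
  simp

theorem idDist_actDom (X : BCat.{s} B) (c a' a : X.carrier) :
    (idDist X).actDom c a' a = X.ι c a' a := by
  dsimp only [Dist.actDom, idDist]
  rw [← Bicategory.whiskerLeft_comp_assoc, Category.assoc, X.ι_ρ_target]
  simp

/-! ### Bilinear families and composites -/

section Bilinear

variable {X Y Z : BCat.{s} B}

/-- A family of 2-cells `ψ(d,c) φ(c,a) ⟹ χ(d,a)` which is balanced over the middle enriched
category and commutes with the outer one-sided actions. -/
structure IsBilinear (φ : Dist X Y) (ψ : Dist Y Z) (χ : Dist X Z)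
    (e : ∀ (d : Z.carrier) (a : X.carrier) (c : Y.carrier),
      φ.hom c a ≫ ψ.hom d c ⟶ χ.hom d a) : Prop where
  isCowedge : ∀ (d : Z.carrier) (a : X.carrier), IsCowedge φ ψ d a (χ.hom d a) (e d a)
  actCod : ∀ (d₁ d₂ : Z.carrier) (a : X.carrier) (c : Y.carrier),
    e d₂ a c ▷ Z.M d₁ d₂ ≫ χ.actCod d₁ d₂ a =
      (α_ _ _ _).hom ≫ φ.hom c a ◁ ψ.actCod d₁ d₂ c ≫ e d₁ a c
  actDom : ∀ (d : Z.carrier) (a₂ a₁ : X.carrier) (c : Y.carrier),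
    X.M a₂ a₁ ◁ e d a₂ c ≫ χ.actDom d a₂ a₁ =
      (α_ _ _ _).inv ≫ φ.actDom c a₂ a₁ ▷ ψ.hom d c ≫ e d a₁ c

variable {φ : Dist X Y} {ψ : Dist Y Z} {χ : Dist X Z}
  {e : ∀ (d : Z.carrier) (a : X.carrier) (c : Y.carrier), φ.hom c a ≫ ψ.hom d c ⟶ χ.hom d a}

/-- Inserting a unit on one side of `e_δ` isolates the action on the other side; the unit law of `φ`
or of `ψ` absorbs what is left. -/
theorem IsComposite.isBilinear (h : IsComposite φ ψ χ e) : IsBilinear φ ψ χ e where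
  isCowedge d a := (h.universal d a).isCowedge
  actCod d₁ d₂ a c := by
    dsimp only [Dist.actCod]
    rw [leftUnitor_inv_naturality_assoc, whisker_exchange_assoc, h.e_δ]
    have := φ.actDom_unit c a
    calc
      _ = (λ_ _).inv ≫ 𝟙 _ ◁ (α_ _ _ _).hom ≫ (α_ _ _ _).inv ≫
            (X.ρ a ▷ φ.hom c a ≫ φ.actDom c a a) ▷ (ψ.hom d₂ c ≫ Z.M d₁ d₂) ≫
            φ.hom c a ◁ ψ.actCod d₁ d₂ c ≫ e d₁ a c := by bicategory
      _ = _ := by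
        rw [this]
        dsimp only [Dist.actCod]
        bicategory
  actDom d a₂ a₁ c := by
    dsimp only [Dist.actDom]
    rw [← Bicategory.whiskerLeft_comp_assoc, ← Category.assoc (e d a₂ c),
      rightUnitor_inv_naturality, Category.assoc, ← whisker_exchange, Bicategory.whiskerLeft_comp,
      Bicategory.whiskerLeft_comp, Category.assoc, Category.assoc, h.e_δ]
    have := ψ.actCod_unit d c
    calc
      _ = X.M a₂ a₁ ◁ (ρ_ _).inv ≫ X.M a₂ a₁ ◁ (α_ _ _ _).hom ≫ (α_ _ _ _).inv ≫
            (X.M a₂ a₁ ≫ φ.hom c a₂) ◁ ψ.hom d c ◁ Z.ρ d ≫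
            φ.actDom c a₂ a₁ ▷ (ψ.hom d c ≫ Z.M d d) ≫
            φ.hom c a₁ ◁ ψ.actCod d d c ≫ e d a₁ c := by bicategory
      _ = _ := by
        rw [whisker_exchange_assoc, ← Bicategory.whiskerLeft_comp_assoc (φ.hom c a₁), this]
        dsimp only [Dist.actDom]
        bicategory

/-- Since `δ` is the composite of the two one-sided actions, compatibility with each of them gives
compatibility with `δ`. -/
theorem IsBilinear.isComposite (h : IsBilinear φ ψ χ e)
    (hu : ∀ d a, IsUniversalCowedge φ ψ d a (χ.hom d a) (e d a)) : IsComposite φ ψ χ e where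
  universal := hu
  e_δ d₁ d₂ a₂ a₁ c := by
    rw [← χ.whiskerLeft_actCod_comp_actDom, ← Bicategory.whiskerLeft_comp_assoc, h.actCod]
    simp only [Bicategory.whiskerLeft_comp, Category.assoc, h.actDom]
    rw [← whisker_exchange_assoc]
    simp

end Bilinear

/-! ### Universal cowedges as universal families. -/

section Universal

variable {X Y Z : BCat.{s} B} {φ : Dist X Y} {ψ : Dist Y Z} {d : Z.carrier} {a : X.carrier}
  {w : X.typ a ⟶ Z.typ d} {e : ∀ c : Y.carrier, φ.hom c a ≫ ψ.hom d c ⟶ w}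

/-- The relations are indexed by pairs of middle objects, and the two notions differ only in the
bracketing of the right leg. This gives coends access to the preservation results for universal
families. -/
theorem isUniversalCowedge_iff : IsUniversalCowedge φ ψ d a w e ↔
    IsUniversalFamily (P := fun c => φ.hom c a ≫ ψ.hom d c)
      (Q := fun j : Y.carrier × Y.carrier => (φ.hom j.2 a ≫ Y.M j.1 j.2) ≫ ψ.hom d j.1)
      (σ := Prod.fst) (τ := Prod.snd) (fun j => φ.actCod j.1 j.2 a ▷ ψ.hom d j.1)
      (fun j => (α_ _ _ _).hom ≫ φ.hom j.2 a ◁ ψ.actDom d j.1 j.2) e := by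
  constructor
  · intro h
    refine ⟨fun j => (h.isCowedge j.1 j.2).trans (Category.assoc _ _ _).symm, fun w' e' he' => ?_⟩
    exact h.existsUnique w' e' fun c₁ c₂ => (he' (c₁, c₂)).trans (Category.assoc _ _ _)
  · intro h
    refine ⟨fun c₁ c₂ => (h.condition (c₁, c₂)).trans (Category.assoc _ _ _), fun w' e' he' => ?_⟩
    exact h.existsUnique w' e' fun j => (he' j.1 j.2).trans (Category.assoc _ _ _).symm

namespace IsUniversalCowedge

variable (h : IsUniversalCowedge φ ψ d a w e)
include h

theorem hom_ext {w' : X.typ a ⟶ Z.typ d} {f g : w ⟶ w'} (hfg : ∀ c, e c ≫ f = e c ≫ g) :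
    f = g :=
  (isUniversalCowedge_iff.1 h).hom_ext hfg

theorem whiskerLeft_hom_ext (hB : IsClosedBicategory B) {x : B} (k : x ⟶ X.typ a)
    {w' : x ⟶ Z.typ d} {f g : k ≫ w ⟶ w'} (hfg : ∀ c, k ◁ e c ≫ f = k ◁ e c ≫ g) : f = g :=
  ((isUniversalCowedge_iff.1 h).whiskerLeft hB k).hom_ext hfg

theorem whiskerRight_hom_ext (hB : IsClosedBicategory B) {x : B} (k : Z.typ d ⟶ x)
    {w' : X.typ a ⟶ x} {f g : w ≫ k ⟶ w'} (hfg : ∀ c, e c ▷ k ≫ f = e c ▷ k ≫ g) : f = g :=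
  ((isUniversalCowedge_iff.1 h).whiskerRight hB k).hom_ext hfg

theorem whiskerLeft_whiskerRight_hom_ext (hB : IsClosedBicategory B) {x y : B}
    (k : x ⟶ X.typ a) (l : Z.typ d ⟶ y) {w' : x ⟶ y} {f g : k ≫ w ≫ l ⟶ w'}
    (hfg : ∀ c, k ◁ (e c ▷ l) ≫ f = k ◁ (e c ▷ l) ≫ g) : f = g :=
  (((isUniversalCowedge_iff.1 h).whiskerRight hB l).whiskerLeft hB k).hom_ext hfg

theorem exists_whiskerLeft_desc (hB : IsClosedBicategory B) {x : B} (k : x ⟶ X.typ a)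
    {w' : x ⟶ Z.typ d} (e' : ∀ c, k ≫ φ.hom c a ≫ ψ.hom d c ⟶ w')
    (he' : ∀ c₁ c₂, k ◁ (φ.actCod c₁ c₂ a ▷ ψ.hom d c₁) ≫ e' c₁ =
      k ◁ (α_ _ _ _).hom ≫ k ◁ φ.hom c₂ a ◁ ψ.actDom d c₁ c₂ ≫ e' c₂) :
    ∃ f : k ≫ w ⟶ w', ∀ c, k ◁ e c ≫ f = e' c :=
  (((isUniversalCowedge_iff.1 h).whiskerLeft hB k).existsUnique w' e' fun j => by
    simpa using he' j.1 j.2).exists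

theorem exists_whiskerRight_desc (hB : IsClosedBicategory B) {x : B} (k : Z.typ d ⟶ x)
    {w' : X.typ a ⟶ x} (e' : ∀ c, (φ.hom c a ≫ ψ.hom d c) ≫ k ⟶ w')
    (he' : ∀ c₁ c₂, (φ.actCod c₁ c₂ a ▷ ψ.hom d c₁) ▷ k ≫ e' c₁ =
      (α_ _ _ _).hom ▷ k ≫ (φ.hom c₂ a ◁ ψ.actDom d c₁ c₂) ▷ k ≫ e' c₂) :
    ∃ f : w ≫ k ⟶ w', ∀ c, e c ▷ k ≫ f = e' c :=
  (((isUniversalCowedge_iff.1 h).whiskerRight hB k).existsUnique w' e' fun j => by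
    simpa using he' j.1 j.2).exists

end IsUniversalCowedge

end Universal

/-! ### Existence of composites -/

theorem exists_isUniversalCowedge (hcocomplete : IsLocallyCocomplete.{s} B) {X Y Z : BCat.{s} B}
    (φ : Dist X Y) (ψ : Dist Y Z) (d : Z.carrier) (a : X.carrier) :
    ∃ (w : X.typ a ⟶ Z.typ d) (e : ∀ c : Y.carrier, φ.hom c a ≫ ψ.hom d c ⟶ w),
      IsUniversalCowedge φ ψ d a w e := by
  have := hcocomplete (X.typ a) (Z.typ d)
  simp only [isUniversalCowedge_iff]
  exact exists_isUniversalFamily _ _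

section Composite

variable {X Y Z : BCat.{s} B} {φ : Dist X Y} {ψ : Dist Y Z}
  {w : ∀ (d : Z.carrier) (a : X.carrier), X.typ a ⟶ Z.typ d}
  {e : ∀ (d : Z.carrier) (a : X.carrier) (c : Y.carrier), φ.hom c a ≫ ψ.hom d c ⟶ w d a}

/-- The whiskered coend is still universal, so letting `Z` act on the factor `ψ` only requires that
this respect the balancing over `Y`. It does because the two actions of `ψ` commute. -/
theorem exists_comp_actCod (hB : IsClosedBicategory B)
    (hu : ∀ d a, IsUniversalCowedge φ ψ d a (w d a) (e d a)) (d₁ d₂ : Z.carrier) (a : X.carrier) :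
    ∃ f : w d₂ a ≫ Z.M d₁ d₂ ⟶ w d₁ a, ∀ c, e d₂ a c ▷ Z.M d₁ d₂ ≫ f =
        (α_ _ _ _).hom ≫ φ.hom c a ◁ ψ.actCod d₁ d₂ c ≫ e d₁ a c := by
  refine (hu d₂ a).exists_whiskerRight_desc hB _ _ fun c₁ c₂ => ?_
  have h₁ := (hu d₁ a).isCowedge c₁ c₂
  have h₂ := ψ.comm d₁ d₂ c₁ c₂
  calc
    _ = (α_ _ _ _).hom ≫ φ.actCod c₁ c₂ a ▷ (ψ.hom d₂ c₁ ≫ Z.M d₁ d₂) ≫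
          φ.hom c₁ a ◁ ψ.actCod d₁ d₂ c₁ ≫ e d₁ a c₁ := by bicategory
    _ = (α_ _ _ _).hom ≫ (α_ _ _ _).hom ≫ φ.hom c₂ a ◁ (Y.M c₁ c₂ ◁ ψ.actCod d₁ d₂ c₁ ≫
          ψ.actDom d₁ c₁ c₂) ≫ e d₁ a c₂ := by
      rw [← whisker_exchange_assoc, h₁]
      bicategory
    _ = _ := by
      rw [h₂]
      bicategory

/-- Here `X` acts on the factor `φ`, and the balancing is respected because the two actions of `φ`
commute. -/
theorem exists_comp_actDom (hB : IsClosedBicategory B)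
    (hu : ∀ d a, IsUniversalCowedge φ ψ d a (w d a) (e d a)) (d : Z.carrier) (a₂ a₁ : X.carrier) :
    ∃ f : X.M a₂ a₁ ≫ w d a₂ ⟶ w d a₁, ∀ c, X.M a₂ a₁ ◁ e d a₂ c ≫ f =
        (α_ _ _ _).inv ≫ φ.actDom c a₂ a₁ ▷ ψ.hom d c ≫ e d a₁ c := by
  refine (hu d a₂).exists_whiskerLeft_desc hB _ _ fun c₁ c₂ => ?_
  have h₁ := (hu d a₁).isCowedge c₁ c₂
  have h₂ := φ.comm c₁ c₂ a₂ a₁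
  calc
    _ = (α_ _ _ _).inv ≫ (X.M a₂ a₁ ◁ φ.actCod c₁ c₂ a₂ ≫ φ.actDom c₁ a₂ a₁) ▷ ψ.hom d c₁ ≫
          e d a₁ c₁ := by bicategory
    _ = (α_ _ _ _).inv ≫ (α_ _ _ _).inv ▷ ψ.hom d c₁ ≫
          (φ.actDom c₂ a₂ a₁ ▷ Y.M c₁ c₂) ▷ ψ.hom d c₁ ≫
          φ.actCod c₁ c₂ a₁ ▷ ψ.hom d c₁ ≫ e d a₁ c₁ := by
      rw [h₂]
      bicategory
    _ = X.M a₂ a₁ ◁ (α_ _ _ _).hom ≫ (α_ _ _ _).inv ≫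
          φ.actDom c₂ a₂ a₁ ▷ (Y.M c₁ c₂ ≫ ψ.hom d c₁) ≫
          φ.hom c₂ a₁ ◁ ψ.actDom d c₁ c₂ ≫ e d a₁ c₂ := by
      rw [h₁]
      bicategory
    _ = _ := by
      rw [← whisker_exchange_assoc]
      bicategory

/-- On the generators `e c` the induced action is that of `ψ`, so the law is inherited from `ψ`; the
other module laws below are inherited in the same way. -/
theorem comp_actCod_unit (hB : IsClosedBicategory B)
    (hu : ∀ d a, IsUniversalCowedge φ ψ d a (w d a) (e d a))
    {cod : ∀ (d₁ d₂ : Z.carrier) (a : X.carrier), w d₂ a ≫ Z.M d₁ d₂ ⟶ w d₁ a}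
    (cod_e : ∀ d₁ d₂ a c, e d₂ a c ▷ Z.M d₁ d₂ ≫ cod d₁ d₂ a =
      (α_ _ _ _).hom ≫ φ.hom c a ◁ ψ.actCod d₁ d₂ c ≫ e d₁ a c)
    (d : Z.carrier) (a : X.carrier) :
    w d a ◁ Z.ρ d ≫ cod d d a = (ρ_ _).hom := by
  refine (hu d a).whiskerRight_hom_ext hB _ fun c => ?_
  rw [← whisker_exchange_assoc, cod_e, comp_whiskerLeft, Category.assoc, Category.assoc,
    Iso.inv_hom_id_assoc, ← Bicategory.whiskerLeft_comp_assoc, ψ.actCod_unit]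
  bicategory

theorem comp_actDom_unit (hB : IsClosedBicategory B)
    (hu : ∀ d a, IsUniversalCowedge φ ψ d a (w d a) (e d a))
    {dom : ∀ (d : Z.carrier) (a₂ a₁ : X.carrier), X.M a₂ a₁ ≫ w d a₂ ⟶ w d a₁}
    (dom_e : ∀ d a₂ a₁ c, X.M a₂ a₁ ◁ e d a₂ c ≫ dom d a₂ a₁ =
      (α_ _ _ _).inv ≫ φ.actDom c a₂ a₁ ▷ ψ.hom d c ≫ e d a₁ c)
    (d : Z.carrier) (a : X.carrier) :
    X.ρ a ▷ w d a ≫ dom d a a = (λ_ _).hom := by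
  refine (hu d a).whiskerLeft_hom_ext hB _ fun c => ?_
  rw [whisker_exchange_assoc, dom_e, whiskerRight_comp, Category.assoc, Category.assoc,
    Iso.hom_inv_id_assoc, ← comp_whiskerRight_assoc, φ.actDom_unit]
  bicategory

theorem comp_actCod_assoc (hB : IsClosedBicategory B)
    (hu : ∀ d a, IsUniversalCowedge φ ψ d a (w d a) (e d a))
    {cod : ∀ (d₁ d₂ : Z.carrier) (a : X.carrier), w d₂ a ≫ Z.M d₁ d₂ ⟶ w d₁ a}
    (cod_e : ∀ d₁ d₂ a c, e d₂ a c ▷ Z.M d₁ d₂ ≫ cod d₁ d₂ a =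
      (α_ _ _ _).hom ≫ φ.hom c a ◁ ψ.actCod d₁ d₂ c ≫ e d₁ a c)
    (d₁ d₂ d₃ : Z.carrier) (a : X.carrier) :
    cod d₂ d₃ a ▷ Z.M d₁ d₂ ≫ cod d₁ d₂ a =
      (α_ _ _ _).hom ≫ w d₃ a ◁ Z.ι d₁ d₂ d₃ ≫ cod d₁ d₃ a := by
  -- Rebracketing leaves the coend whiskered by a single 1-cell, which is the form that the
  -- extensionality lemma accepts.
  rw [← cancel_epi (α_ _ _ _).inv]
  refine (hu d₃ a).whiskerRight_hom_ext hB _ fun c => ?_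
  calc
    _ = (α_ _ _ _).inv ≫ (e d₃ a c ▷ Z.M d₂ d₃ ≫ cod d₂ d₃ a) ▷ Z.M d₁ d₂ ≫ cod d₁ d₂ a := by
      bicategory
    _ = (α_ _ _ _).inv ≫ (α_ _ _ _).hom ▷ Z.M d₁ d₂ ≫ (α_ _ _ _).hom ≫
          φ.hom c a ◁ (ψ.actCod d₂ d₃ c ▷ Z.M d₁ d₂ ≫ ψ.actCod d₁ d₂ c) ≫ e d₁ a c := by
      rw [cod_e, comp_whiskerRight, comp_whiskerRight, Category.assoc, Category.assoc, cod_e]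
      bicategory
    _ = (φ.hom c a ≫ ψ.hom d₃ c) ◁ Z.ι d₁ d₂ d₃ ≫ e d₃ a c ▷ Z.M d₁ d₃ ≫ cod d₁ d₃ a := by
      rw [cod_e, ψ.actCod_assoc]
      bicategory
    _ = _ := by
      rw [whisker_exchange_assoc, Iso.inv_hom_id_assoc]

theorem comp_actDom_assoc (hB : IsClosedBicategory B)
    (hu : ∀ d a, IsUniversalCowedge φ ψ d a (w d a) (e d a))
    {dom : ∀ (d : Z.carrier) (a₂ a₁ : X.carrier), X.M a₂ a₁ ≫ w d a₂ ⟶ w d a₁}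
    (dom_e : ∀ d a₂ a₁ c, X.M a₂ a₁ ◁ e d a₂ c ≫ dom d a₂ a₁ =
      (α_ _ _ _).inv ≫ φ.actDom c a₂ a₁ ▷ ψ.hom d c ≫ e d a₁ c)
    (d : Z.carrier) (a₁ a₂ a₃ : X.carrier) :
    X.M a₂ a₁ ◁ dom d a₃ a₂ ≫ dom d a₂ a₁ =
      (α_ _ _ _).inv ≫ X.ι a₃ a₂ a₁ ▷ w d a₃ ≫ dom d a₃ a₁ := by
  rw [← cancel_epi (α_ _ _ _).hom]
  refine (hu d a₃).whiskerLeft_hom_ext hB _ fun c => ?_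
  calc
    _ = (α_ _ _ _).hom ≫ X.M a₂ a₁ ◁ (X.M a₃ a₂ ◁ e d a₃ c ≫ dom d a₃ a₂) ≫ dom d a₂ a₁ := by
      bicategory
    _ = (α_ _ _ _).hom ≫ X.M a₂ a₁ ◁ (α_ _ _ _).inv ≫ (α_ _ _ _).inv ≫
          (X.M a₂ a₁ ◁ φ.actDom c a₃ a₂ ≫ φ.actDom c a₂ a₁) ▷ ψ.hom d c ≫ e d a₁ c := by
      rw [dom_e, Bicategory.whiskerLeft_comp, Bicategory.whiskerLeft_comp, Category.assoc,
        Category.assoc, dom_e]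
      bicategory
    _ = X.ι a₃ a₂ a₁ ▷ (φ.hom c a₃ ≫ ψ.hom d c) ≫ X.M a₃ a₁ ◁ e d a₃ c ≫ dom d a₃ a₁ := by
      rw [dom_e, φ.actDom_assoc]
      bicategory
    _ = _ := by
      rw [← whisker_exchange_assoc, Iso.hom_inv_id_assoc]

/-- One action touches only the factor `ψ` and the other only the factor `φ`, so on generators they
commute by interchange. -/
theorem comp_act_comm (hB : IsClosedBicategory B)
    (hu : ∀ d a, IsUniversalCowedge φ ψ d a (w d a) (e d a))
    {cod : ∀ (d₁ d₂ : Z.carrier) (a : X.carrier), w d₂ a ≫ Z.M d₁ d₂ ⟶ w d₁ a}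
    (cod_e : ∀ d₁ d₂ a c, e d₂ a c ▷ Z.M d₁ d₂ ≫ cod d₁ d₂ a =
      (α_ _ _ _).hom ≫ φ.hom c a ◁ ψ.actCod d₁ d₂ c ≫ e d₁ a c)
    {dom : ∀ (d : Z.carrier) (a₂ a₁ : X.carrier), X.M a₂ a₁ ≫ w d a₂ ⟶ w d a₁}
    (dom_e : ∀ d a₂ a₁ c, X.M a₂ a₁ ◁ e d a₂ c ≫ dom d a₂ a₁ =
      (α_ _ _ _).inv ≫ φ.actDom c a₂ a₁ ▷ ψ.hom d c ≫ e d a₁ c)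
    (d d' : Z.carrier) (a' a : X.carrier) :
    X.M a' a ◁ cod d d' a' ≫ dom d a' a =
      (α_ _ _ _).inv ≫ dom d' a' a ▷ Z.M d d' ≫ cod d d' a := by
  refine (hu d' a').whiskerLeft_whiskerRight_hom_ext hB _ _ fun c => ?_
  calc
    _ = X.M a' a ◁ (α_ _ _ _).hom ≫ X.M a' a ◁ φ.hom c a' ◁ ψ.actCod d d' c ≫
          X.M a' a ◁ e d a' c ≫ dom d a' a := by
      rw [← Bicategory.whiskerLeft_comp_assoc, cod_e, Bicategory.whiskerLeft_comp,
        Bicategory.whiskerLeft_comp, Category.assoc, Category.assoc]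
    _ = X.M a' a ◁ (α_ _ _ _).hom ≫ (α_ _ _ _).inv ≫
          (X.M a' a ≫ φ.hom c a') ◁ ψ.actCod d d' c ≫ φ.actDom c a' a ▷ ψ.hom d c ≫
          e d a c := by
      rw [dom_e]
      bicategory
    _ = (α_ _ _ _).inv ≫ ((α_ _ _ _).inv ≫ φ.actDom c a' a ▷ ψ.hom d' c) ▷ Z.M d d' ≫
          (α_ _ _ _).hom ≫ φ.hom c a ◁ ψ.actCod d d' c ≫ e d a c := by
      rw [whisker_exchange_assoc]
      bicategory
    _ = (α_ _ _ _).inv ≫ ((α_ _ _ _).inv ≫ φ.actDom c a' a ▷ ψ.hom d' c ≫ e d' a c) ▷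
          Z.M d d' ≫ cod d d' a := by
      rw [← cod_e]
      bicategory
    _ = _ := by
      rw [← dom_e]
      bicategory

end Composite

theorem exists_isComposite (hcocomplete : IsLocallyCocomplete.{s} B) (hB : IsClosedBicategory B)
    {X Y Z : BCat.{s} B} (φ : Dist X Y) (ψ : Dist Y Z) :
    ∃ (χ : Dist X Z) (e : ∀ (d : Z.carrier) (a : X.carrier) (c : Y.carrier),
      φ.hom c a ≫ ψ.hom d c ⟶ χ.hom d a), IsComposite φ ψ χ e := by
  choose w e hu using exists_isUniversalCowedge hcocomplete φ ψ
  choose cod cod_e using exists_comp_actCod hB hu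
  choose dom dom_e using exists_comp_actDom hB hu
  refine ⟨Dist.ofActions w cod dom (comp_actCod_unit hB hu cod_e) (comp_actDom_unit hB hu dom_e)
    (comp_actCod_assoc hB hu cod_e) (comp_actDom_assoc hB hu dom_e)
    (comp_act_comm hB hu cod_e dom_e), e,
    IsBilinear.isComposite ⟨fun d a => (hu d a).isCowedge, fun d₁ d₂ a c => ?_,
      fun d a₂ a₁ c => ?_⟩ hu⟩
  · refine Eq.trans ?_ (cod_e d₁ d₂ a c)
    exact congrArg (e d₂ a c ▷ Z.M d₁ d₂ ≫ ·)
      (congrFun (congrFun (congrFun (Dist.ofActions_actCod ..) d₁) d₂) a)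
  · refine Eq.trans ?_ (dom_e d a₂ a₁ c)
    exact congrArg (X.M a₂ a₁ ◁ e d a₂ c ≫ ·)
      (congrFun (congrFun (congrFun (Dist.ofActions_actDom ..) d) a₂) a₁)

/-! ### Identity distributors -/

section Split

variable {X Y : BCat.{s} B} (φ : Dist X Y) {c : Y.carrier} {a : X.carrier}
  {w : X.typ a ⟶ Y.typ c}

/-- The fork is split by `ρ a`: balancing expresses every member of the family through its member at
`a` precomposed with the unit. -/
theorem actDom_comp_of_balanced (e : ∀ a', X.M a' a ≫ φ.hom c a' ⟶ w)
    (he : ∀ a₁ a₂, X.ι a₁ a₂ a ▷ φ.hom c a₁ ≫ e a₁ =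
      (α_ _ _ _).hom ≫ X.M a₂ a ◁ φ.actDom c a₁ a₂ ≫ e a₂) (a' : X.carrier) :
    φ.actDom c a' a ≫ (λ_ _).inv ≫ X.ρ a ▷ φ.hom c a ≫ e a = e a' := by
  have h := he a' a
  rw [← Iso.inv_comp_eq] at h
  rw [leftUnitor_inv_naturality_assoc, whisker_exchange_assoc, ← h, whiskerRight_comp,
    Category.assoc, Category.assoc, Iso.hom_inv_id_assoc, ← comp_whiskerRight_assoc,
    X.ι_ρ_source]
  simp

theorem actCod_comp_of_balanced (e : ∀ c', φ.hom c' a ≫ Y.M c c' ⟶ w)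
    (he : ∀ c₁ c₂, φ.actCod c₁ c₂ a ▷ Y.M c c₁ ≫ e c₁ =
      (α_ _ _ _).hom ≫ φ.hom c₂ a ◁ Y.ι c c₁ c₂ ≫ e c₂) (c' : Y.carrier) :
    φ.actCod c c' a ≫ (ρ_ _).inv ≫ φ.hom c a ◁ Y.ρ c ≫ e c = e c' := by
  rw [rightUnitor_inv_naturality_assoc, ← whisker_exchange_assoc, he, comp_whiskerLeft,
    Category.assoc, Category.assoc, Iso.inv_hom_id_assoc,
    ← Bicategory.whiskerLeft_comp_assoc (φ.hom c' a), Y.ι_ρ_target]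
  simp

/-- The unit is a section of the action at `a`, so a factorization through the action is determined
by its component there. -/
theorem eq_of_actDom_comp {k : φ.hom c a ⟶ w} {e : X.M a a ≫ φ.hom c a ⟶ w}
    (h : φ.actDom c a a ≫ k = e) : k = (λ_ _).inv ≫ X.ρ a ▷ φ.hom c a ≫ e := by
  rw [← h, reassoc_of% φ.actDom_unit, Iso.inv_hom_id_assoc]

theorem eq_of_actCod_comp {k : φ.hom c a ⟶ w} {e : φ.hom c a ≫ Y.M c c ⟶ w}
    (h : φ.actCod c c a ≫ k = e) : k = (ρ_ _).inv ≫ φ.hom c a ◁ Y.ρ c ≫ e := by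
  rw [← h, reassoc_of% φ.actCod_unit, Iso.inv_hom_id_assoc]

end Split

/-- A co-Yoneda argument: associativity makes the action balanced, and the splitting by the unit
makes it universal. Bilinearity consists of `comm` and associativity. -/
theorem isComposite_idDist_left {X Y : BCat.{s} B} (φ : Dist X Y) :
    IsComposite (idDist X) φ φ (fun c a a' => φ.actDom c a' a) := by
  have hc : ∀ c a, IsCowedge (idDist X) φ c a (φ.hom c a) fun a' => φ.actDom c a' a := by
    intro c a a₁ a₂
    rw [idDist_actCod]
    have := φ.actDom_assoc c a a₂ a₁
    rw [Iso.eq_inv_comp] at this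
    exact this.symm
  refine IsBilinear.isComposite ⟨hc, fun c c' a a' => ?_, fun c a₂ a₁ a => ?_⟩ fun c a =>
    ⟨hc c a, fun w' e' he' => ⟨(λ_ _).inv ≫ X.ρ a ▷ _ ≫ e' a, fun a' => ?_, fun k hk => ?_⟩⟩
  · have := φ.comm c c' a' a
    rw [Iso.eq_inv_comp] at this
    exact this.symm
  · rw [idDist_actDom]
    exact φ.actDom_assoc c a₁ a₂ a
  · refine actDom_comp_of_balanced φ e' (fun a₁ a₂ => ?_) a'
    rw [← idDist_actCod]
    exact he' a₁ a₂
  · exact eq_of_actDom_comp φ (hk a)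

theorem isComposite_idDist_right {X Y : BCat.{s} B} (φ : Dist X Y) :
    IsComposite φ (idDist Y) φ (fun c a c' => φ.actCod c c' a) := by
  have hc : ∀ c a, IsCowedge φ (idDist Y) c a (φ.hom c a) fun c' => φ.actCod c c' a := by
    intro c a c₁ c₂
    rw [idDist_actDom]
    exact φ.actCod_assoc c c₁ c₂ a
  refine IsBilinear.isComposite ⟨hc, fun c c' a c₁ => ?_, fun c a₂ a₁ c' => ?_⟩ fun c a =>
    ⟨hc c a, fun w' e' he' => ⟨(ρ_ _).inv ≫ _ ◁ Y.ρ c ≫ e' c, fun a' => ?_, fun k hk => ?_⟩⟩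
  · rw [idDist_actCod]
    exact φ.actCod_assoc c c' c₁ a
  · exact φ.comm c c' a₂ a₁
  · refine actCod_comp_of_balanced φ e' (fun c₁ c₂ => ?_) a'
    rw [← idDist_actDom]
    exact he' c₁ c₂
  · exact eq_of_actCod_comp φ (hk c)

/-! ### Morphisms out of a composite -/

/-- Each component comes from the coend at `(d,a)`. Compatibility with the outer actions is an
equation out of a whiskered coend, so it may be tested on generators. -/
theorem IsComposite.exists_desc (hB : IsClosedBicategory B) {X Y Z : BCat.{s} B} {φ : Dist X Y}
    {ψ : Dist Y Z} {χ χ' : Dist X Z} {e : ∀ d a c, φ.hom c a ≫ ψ.hom d c ⟶ χ.hom d a}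
    (h : IsComposite φ ψ χ e) {e' : ∀ d a c, φ.hom c a ≫ ψ.hom d c ⟶ χ'.hom d a}
    (h' : IsBilinear φ ψ χ' e') :
    ∃ f : DistHom χ χ', ∀ d a c, e d a c ≫ f.app d a = e' d a c := by
  choose f hf _ using fun d a => (h.universal d a).existsUnique _ _ (h'.isCowedge d a)
  refine ⟨⟨f, fun d₁ d₂ a => ?_, fun d a₁ a₂ => ?_⟩, hf⟩
  · refine (h.universal d₂ a).whiskerRight_hom_ext hB _ fun c => ?_
    rw [reassoc_of% h.isBilinear.actCod, hf, ← comp_whiskerRight_assoc, hf, h'.actCod]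
  · refine (h.universal d a₁).whiskerLeft_hom_ext hB _ fun c => ?_
    rw [reassoc_of% h.isBilinear.actDom, hf, ← Bicategory.whiskerLeft_comp_assoc, hf, h'.actDom]

section DistHom

variable {X Y : BCat.{s} B} {φ ψ χ : Dist X Y}

@[simp]
theorem id_app (φ : Dist X Y) (c : Y.carrier) (a : X.carrier) :
    DistHom.app (𝟙 φ) c a = 𝟙 (φ.hom c a) := rfl

@[simp]
theorem comp_app (f : φ ⟶ ψ) (g : ψ ⟶ χ) (c : Y.carrier) (a : X.carrier) :
    DistHom.app (f ≫ g) c a = DistHom.app f c a ≫ DistHom.app g c a := rfl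

end DistHom

namespace DistComposition

variable (K : DistComposition.{s} B) {X Y Z W V : BCat.{s} B}

theorem isBilinear (φ : Dist X Y) (ψ : Dist Y Z) : IsBilinear φ ψ (K.comp φ ψ) (K.e φ ψ) :=
  (K.isComposite φ ψ).isBilinear

theorem cowedge (φ : Dist X Y) (ψ : Dist Y Z) (d : Z.carrier) (a : X.carrier)
    (c₁ c₂ : Y.carrier) : φ.actCod c₁ c₂ a ▷ ψ.hom d c₁ ≫ K.e φ ψ d a c₁ =
      (α_ (φ.hom c₂ a) (Y.M c₁ c₂) (ψ.hom d c₁)).hom ≫ φ.hom c₂ a ◁ ψ.actDom d c₁ c₂ ≫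
        K.e φ ψ d a c₂ :=
  (K.isBilinear φ ψ).isCowedge d a c₁ c₂

variable {K} in
theorem hom_ext {φ : Dist X Y} {ψ : Dist Y Z} {χ : Dist X Z} {f g : K.comp φ ψ ⟶ χ}
    (h : ∀ d a c, K.e φ ψ d a c ≫ DistHom.app f d a = K.e φ ψ d a c ≫ DistHom.app g d a) :
    f = g :=
  DistHom.ext (funext fun d => funext fun a =>
    ((K.isComposite φ ψ).universal d a).hom_ext (h d a))

variable {K} in
-- A triple composite is a coend of whiskered coends, and whiskering keeps the inner generators
-- jointly epic.
theorem hom_ext_left (hB : IsClosedBicategory B) {φ : Dist X Y} {ψ : Dist Y Z} {χ : Dist Z W}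
    {θ : Dist X W} {f g : K.comp (K.comp φ ψ) χ ⟶ θ}
    (h : ∀ x a d c, K.e φ ψ d a c ▷ χ.hom x d ≫ K.e (K.comp φ ψ) χ x a d ≫ DistHom.app f x a =
      K.e φ ψ d a c ▷ χ.hom x d ≫ K.e (K.comp φ ψ) χ x a d ≫ DistHom.app g x a) : f = g :=
  hom_ext fun x a d => ((K.isComposite φ ψ).universal d a).whiskerRight_hom_ext hB _ (h x a d)

variable {K} in
theorem hom_ext_right (hB : IsClosedBicategory B) {φ : Dist X Y} {ψ : Dist Y Z} {χ : Dist Z W}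
    {θ : Dist X W} {f g : K.comp φ (K.comp ψ χ) ⟶ θ}
    (h : ∀ x a c d, φ.hom c a ◁ K.e ψ χ x c d ≫ K.e φ (K.comp ψ χ) x a c ≫ DistHom.app f x a =
      φ.hom c a ◁ K.e ψ χ x c d ≫ K.e φ (K.comp ψ χ) x a c ≫ DistHom.app g x a) : f = g :=
  hom_ext fun x a c => ((K.isComposite ψ χ).universal x c).whiskerLeft_hom_ext hB _ (h x a c)

theorem exists_desc (hB : IsClosedBicategory B) {φ : Dist X Y} {ψ : Dist Y Z} {χ : Dist X Z}
    {e : ∀ d a c, φ.hom c a ≫ ψ.hom d c ⟶ χ.hom d a} (h : IsBilinear φ ψ χ e) :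
    ∃ f : DistHom (K.comp φ ψ) χ, ∀ d a c, K.e φ ψ d a c ≫ f.app d a = e d a c :=
  (K.isComposite φ ψ).exists_desc hB h

/-- The morphism out of a composite induced by a bilinear family. -/
noncomputable def desc (hB : IsClosedBicategory B) {φ : Dist X Y} {ψ : Dist Y Z} {χ : Dist X Z}
    {e : ∀ d a c, φ.hom c a ≫ ψ.hom d c ⟶ χ.hom d a} (h : IsBilinear φ ψ χ e) :
    K.comp φ ψ ⟶ χ :=
  (K.exists_desc hB h).choose

theorem e_desc (hB : IsClosedBicategory B) {φ : Dist X Y} {ψ : Dist Y Z} {χ : Dist X Z}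
    {e : ∀ d a c, φ.hom c a ≫ ψ.hom d c ⟶ χ.hom d a} (h : IsBilinear φ ψ χ e) (d : Z.carrier)
    (a : X.carrier) (c : Y.carrier) :
    K.e φ ψ d a c ≫ DistHom.app (K.desc hB h) d a = e d a c :=
  (K.exists_desc hB h).choose_spec d a c

/-! ### Whiskering -/

theorem isBilinear_whiskerLeft (φ : Dist X Y) {ψ₁ ψ₂ : Dist Y Z} (g : DistHom ψ₁ ψ₂) :
    IsBilinear φ ψ₁ (K.comp φ ψ₂) fun d a c => φ.hom c a ◁ g.app d c ≫ K.e φ ψ₂ d a c where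
  isCowedge d a c₁ c₂ := by
    rw [← whisker_exchange_assoc, K.cowedge, ← Bicategory.whiskerLeft_comp_assoc (φ.hom c₂ a),
      g.app_actDom]
    bicategory
  actCod d₁ d₂ a c := by
    rw [comp_whiskerRight, Category.assoc, (K.isBilinear φ ψ₂).actCod,
      ← Bicategory.whiskerLeft_comp_assoc (φ.hom c a), g.app_actCod]
    bicategory
  actDom d a₂ a₁ c := by
    rw [Bicategory.whiskerLeft_comp, Category.assoc, (K.isBilinear φ ψ₂).actDom,
      ← whisker_exchange_assoc]
    bicategory

theorem isBilinear_whiskerRight {φ₁ φ₂ : Dist X Y} (f : DistHom φ₁ φ₂) (ψ : Dist Y Z) :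
    IsBilinear φ₁ ψ (K.comp φ₂ ψ) fun d a c => f.app c a ▷ ψ.hom d c ≫ K.e φ₂ ψ d a c where
  isCowedge d a c₁ c₂ := by
    rw [← comp_whiskerRight_assoc, f.app_actCod, comp_whiskerRight, Category.assoc, K.cowedge,
      whisker_exchange_assoc]
    bicategory
  actCod d₁ d₂ a c := by
    rw [comp_whiskerRight, Category.assoc, (K.isBilinear φ₂ ψ).actCod, whisker_exchange_assoc]
    bicategory
  actDom d a₂ a₁ c := by
    rw [Bicategory.whiskerLeft_comp, Category.assoc, (K.isBilinear φ₂ ψ).actDom,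
      ← comp_whiskerRight_assoc, f.app_actDom]
    bicategory

/-! ### The associator -/

/-- The first of the two descents for the associator: `d` is fixed and the coend over `c` is
eliminated. The family is balanced in `c` because `Y` acts on the composite of `ψ` and `χ` through
`ψ`. -/
theorem exists_trilinear_left (hB : IsClosedBicategory B) (φ : Dist X Y) (ψ : Dist Y Z)
    (χ : Dist Z W) (x : W.carrier) (a : X.carrier) (d : Z.carrier) :
    ∃ t : (K.comp φ ψ).hom d a ≫ χ.hom x d ⟶ (K.comp φ (K.comp ψ χ)).hom x a,
      ∀ c, K.e φ ψ d a c ▷ χ.hom x d ≫ t = (α_ _ _ _).hom ≫ φ.hom c a ◁ K.e ψ χ x c d ≫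
        K.e φ (K.comp ψ χ) x a c := by
  refine ((K.isComposite φ ψ).universal d a).exists_whiskerRight_desc hB _ _ fun c₁ c₂ => ?_
  have h₁ := K.cowedge φ (K.comp ψ χ) x a c₁ c₂
  have h₂ := (K.isBilinear ψ χ).actDom x c₁ c₂ d
  calc
    _ = (α_ _ _ _).hom ≫ φ.actCod c₁ c₂ a ▷ (ψ.hom d c₁ ≫ χ.hom x d) ≫
          φ.hom c₁ a ◁ K.e ψ χ x c₁ d ≫ K.e φ (K.comp ψ χ) x a c₁ := by bicategory
    _ = (α_ _ _ _).hom ≫ (α_ _ _ _).hom ≫ φ.hom c₂ a ◁ (Y.M c₁ c₂ ◁ K.e ψ χ x c₁ d ≫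
          (K.comp ψ χ).actDom x c₁ c₂) ≫ K.e φ (K.comp ψ χ) x a c₂ := by
      rw [← whisker_exchange_assoc, h₁]
      bicategory
    _ = _ := by
      rw [h₂]
      bicategory

theorem exists_trilinear_right (hB : IsClosedBicategory B) (φ : Dist X Y) (ψ : Dist Y Z)
    (χ : Dist Z W) (x : W.carrier) (a : X.carrier) (c : Y.carrier) :
    ∃ t : φ.hom c a ≫ (K.comp ψ χ).hom x c ⟶ (K.comp (K.comp φ ψ) χ).hom x a,
      ∀ d, φ.hom c a ◁ K.e ψ χ x c d ≫ t = (α_ _ _ _).inv ≫ K.e φ ψ d a c ▷ χ.hom x d ≫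
        K.e (K.comp φ ψ) χ x a d := by
  refine ((K.isComposite ψ χ).universal x c).exists_whiskerLeft_desc hB _ _ fun d₁ d₂ => ?_
  have h₁ := K.cowedge (K.comp φ ψ) χ x a d₁ d₂
  have h₂ := (K.isBilinear φ ψ).actCod d₁ d₂ a c
  calc
    _ = (α_ _ _ _).inv ≫ (α_ _ _ _).inv ▷ χ.hom x d₁ ≫ ((α_ _ _ _).hom ≫
          φ.hom c a ◁ ψ.actCod d₁ d₂ c ≫ K.e φ ψ d₁ a c) ▷ χ.hom x d₁ ≫
          K.e (K.comp φ ψ) χ x a d₁ := by bicategory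
    _ = (α_ _ _ _).inv ≫ (α_ _ _ _).inv ▷ χ.hom x d₁ ≫
          (K.e φ ψ d₂ a c ▷ Z.M d₁ d₂) ▷ χ.hom x d₁ ≫ (α_ _ _ _).hom ≫
          (K.comp φ ψ).hom d₂ a ◁ χ.actDom x d₁ d₂ ≫ K.e (K.comp φ ψ) χ x a d₂ := by
      rw [← h₂, comp_whiskerRight, Category.assoc, h₁]
    _ = φ.hom c a ◁ (α_ _ _ _).hom ≫ (α_ _ _ _).inv ≫ K.e φ ψ d₂ a c ▷ (Z.M d₁ d₂ ≫ χ.hom x d₁) ≫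
          (K.comp φ ψ).hom d₂ a ◁ χ.actDom x d₁ d₂ ≫ K.e (K.comp φ ψ) χ x a d₂ := by
      bicategory
    _ = _ := by
      rw [← whisker_exchange_assoc]
      bicategory

/-- This prepares the second descent, over `d`. Each condition is tested on the generators in `c`,
where it reduces to the same kind of condition on the composites on the right-hand bracketing. -/
theorem isBilinear_trilinear_left (hB : IsClosedBicategory B) {φ : Dist X Y} {ψ : Dist Y Z}
    {χ : Dist Z W}
    {t : ∀ x a d, (K.comp φ ψ).hom d a ≫ χ.hom x d ⟶ (K.comp φ (K.comp ψ χ)).hom x a}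
    (ht : ∀ x a d c, K.e φ ψ d a c ▷ χ.hom x d ≫ t x a d =
      (α_ _ _ _).hom ≫ φ.hom c a ◁ K.e ψ χ x c d ≫ K.e φ (K.comp ψ χ) x a c) :
    IsBilinear (K.comp φ ψ) χ (K.comp φ (K.comp ψ χ)) t where
  isCowedge x a d₁ d₂ := by
    rw [← cancel_epi (α_ _ _ _).inv]
    refine ((K.isComposite φ ψ).universal d₂ a).whiskerRight_hom_ext hB _ fun c => ?_
    have h₁ := (K.isBilinear φ ψ).actCod d₁ d₂ a c
    have h₂ := K.cowedge ψ χ x c d₁ d₂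
    calc
      _ = (α_ _ _ _).inv ≫ (K.e φ ψ d₂ a c ▷ Z.M d₁ d₂ ≫ (K.comp φ ψ).actCod d₁ d₂ a) ▷
            χ.hom x d₁ ≫ t x a d₁ := by bicategory
      _ = (α_ _ _ _).inv ≫ (α_ _ _ _).hom ▷ _ ≫ (φ.hom c a ◁ ψ.actCod d₁ d₂ c) ▷ χ.hom x d₁ ≫
            K.e φ ψ d₁ a c ▷ χ.hom x d₁ ≫ t x a d₁ := by
        rw [h₁, comp_whiskerRight, comp_whiskerRight, Category.assoc, Category.assoc]
      _ = (α_ _ _ _).hom ≫ φ.hom c a ◁ (α_ _ _ _).inv ≫ φ.hom c a ◁ (ψ.actCod d₁ d₂ c ▷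
            χ.hom x d₁ ≫ K.e ψ χ x c d₁) ≫ K.e φ (K.comp ψ χ) x a c := by
        rw [ht]
        bicategory
      _ = (φ.hom c a ≫ ψ.hom d₂ c) ◁ χ.actDom x d₁ d₂ ≫ K.e φ ψ d₂ a c ▷ χ.hom x d₂ ≫
            t x a d₂ := by
        rw [h₂, ht]
        bicategory
      _ = _ := by
        rw [whisker_exchange_assoc, Iso.inv_hom_id_assoc]
  actCod x₁ x₂ a d := by
    rw [← cancel_epi (α_ _ _ _).inv]
    refine ((K.isComposite φ ψ).universal d a).whiskerRight_hom_ext hB _ fun c => ?_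
    have h₁ := (K.isBilinear φ (K.comp ψ χ)).actCod x₁ x₂ a c
    have h₂ := (K.isBilinear ψ χ).actCod x₁ x₂ c d
    calc
      _ = (α_ _ _ _).inv ≫ (K.e φ ψ d a c ▷ χ.hom x₂ d ≫ t x₂ a d) ▷ W.M x₁ x₂ ≫
            (K.comp φ (K.comp ψ χ)).actCod x₁ x₂ a := by bicategory
      _ = (α_ _ _ _).inv ≫ (α_ _ _ _).hom ▷ _ ≫ (α_ _ _ _).hom ≫
            φ.hom c a ◁ (K.e ψ χ x₂ c d ▷ W.M x₁ x₂ ≫ (K.comp ψ χ).actCod x₁ x₂ c) ≫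
            K.e φ (K.comp ψ χ) x₁ a c := by
        rw [ht, comp_whiskerRight, comp_whiskerRight, Category.assoc, Category.assoc, h₁]
        bicategory
      _ = (φ.hom c a ≫ ψ.hom d c) ◁ χ.actCod x₁ x₂ d ≫ K.e φ ψ d a c ▷ χ.hom x₁ d ≫
            t x₁ a d := by
        rw [h₂, ht]
        bicategory
      _ = _ := by
        rw [whisker_exchange_assoc, Iso.inv_hom_id_assoc]
  actDom x a₂ a₁ d := by
    refine ((K.isComposite φ ψ).universal d a₂).whiskerLeft_whiskerRight_hom_ext hB _ _ fun c => ?_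
    have h₁ := (K.isBilinear φ (K.comp ψ χ)).actDom x a₂ a₁ c
    have h₂ := (K.isBilinear φ ψ).actDom d a₂ a₁ c
    calc
      _ = X.M a₂ a₁ ◁ (α_ _ _ _).hom ≫ X.M a₂ a₁ ◁ φ.hom c a₂ ◁ K.e ψ χ x c d ≫
            X.M a₂ a₁ ◁ K.e φ (K.comp ψ χ) x a₂ c ≫
            (K.comp φ (K.comp ψ χ)).actDom x a₂ a₁ := by
        rw [← Bicategory.whiskerLeft_comp_assoc, ht, Bicategory.whiskerLeft_comp,
          Bicategory.whiskerLeft_comp, Category.assoc, Category.assoc]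
      _ = X.M a₂ a₁ ◁ (α_ _ _ _).hom ≫ (α_ _ _ _).inv ≫
            (X.M a₂ a₁ ≫ φ.hom c a₂) ◁ K.e ψ χ x c d ≫
            φ.actDom c a₂ a₁ ▷ (K.comp ψ χ).hom x c ≫ K.e φ (K.comp ψ χ) x a₁ c := by
        rw [h₁]
        bicategory
      _ = (α_ _ _ _).inv ≫ (α_ _ _ _).inv ▷ _ ≫ (φ.actDom c a₂ a₁ ▷ ψ.hom d c) ▷ χ.hom x d ≫
            (α_ _ _ _).hom ≫ φ.hom c a₁ ◁ K.e ψ χ x c d ≫ K.e φ (K.comp ψ χ) x a₁ c := by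
        rw [whisker_exchange_assoc]
        bicategory
      _ = (α_ _ _ _).inv ≫ ((α_ _ _ _).inv ≫ φ.actDom c a₂ a₁ ▷ ψ.hom d c ≫ K.e φ ψ d a₁ c) ▷
            χ.hom x d ≫ t x a₁ d := by
        rw [← ht]
        bicategory
      _ = _ := by
        rw [← h₂]
        bicategory

/-- The mirror image, needed for the inverse of the associator: the coend over `d` is already
eliminated and the one over `c` comes next. -/
theorem isBilinear_trilinear_right (hB : IsClosedBicategory B) {φ : Dist X Y} {ψ : Dist Y Z}
    {χ : Dist Z W}
    {t : ∀ x a c, φ.hom c a ≫ (K.comp ψ χ).hom x c ⟶ (K.comp (K.comp φ ψ) χ).hom x a}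
    (ht : ∀ x a c d, φ.hom c a ◁ K.e ψ χ x c d ≫ t x a c =
      (α_ _ _ _).inv ≫ K.e φ ψ d a c ▷ χ.hom x d ≫ K.e (K.comp φ ψ) χ x a d) :
    IsBilinear φ (K.comp ψ χ) (K.comp (K.comp φ ψ) χ) t where
  isCowedge x a c₁ c₂ := by
    refine ((K.isComposite ψ χ).universal x c₁).whiskerLeft_hom_ext hB _ fun d => ?_
    have h₁ := K.cowedge φ ψ d a c₁ c₂
    have h₂ := (K.isBilinear ψ χ).actDom x c₁ c₂ d
    calc
      _ = (α_ _ _ _).inv ≫ (φ.actCod c₁ c₂ a ▷ ψ.hom d c₁ ≫ K.e φ ψ d a c₁) ▷ χ.hom x d ≫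
            K.e (K.comp φ ψ) χ x a d := by
        rw [whisker_exchange_assoc, ht]
        bicategory
      _ = (α_ _ _ _).hom ≫ φ.hom c₂ a ◁ (α_ _ _ _).inv ≫
            φ.hom c₂ a ◁ (ψ.actDom d c₁ c₂ ▷ χ.hom x d) ≫
            φ.hom c₂ a ◁ K.e ψ χ x c₂ d ≫ t x a c₂ := by
        rw [h₁, ht]
        bicategory
      _ = (α_ _ _ _).hom ≫ φ.hom c₂ a ◁ (Y.M c₁ c₂ ◁ K.e ψ χ x c₁ d ≫
            (K.comp ψ χ).actDom x c₁ c₂) ≫ t x a c₂ := by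
        rw [h₂]
        bicategory
      _ = _ := by bicategory
  actCod x₁ x₂ a c := by
    rw [← cancel_epi (α_ _ _ _).inv]
    refine ((K.isComposite ψ χ).universal x₂ c).whiskerLeft_whiskerRight_hom_ext hB _ _ fun d => ?_
    have h₁ := (K.isBilinear (K.comp φ ψ) χ).actCod x₁ x₂ a d
    have h₂ := (K.isBilinear ψ χ).actCod x₁ x₂ c d
    calc
      _ = (α_ _ _ _).inv ≫ (φ.hom c a ◁ K.e ψ χ x₂ c d ≫ t x₂ a c) ▷ W.M x₁ x₂ ≫
            (K.comp (K.comp φ ψ) χ).actCod x₁ x₂ a := by bicategory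
      _ = (α_ _ _ _).inv ≫ (α_ _ _ _).inv ▷ _ ≫ (K.e φ ψ d a c ▷ χ.hom x₂ d) ▷ W.M x₁ x₂ ≫
            (α_ _ _ _).hom ≫ (K.comp φ ψ).hom d a ◁ χ.actCod x₁ x₂ d ≫
            K.e (K.comp φ ψ) χ x₁ a d := by
        rw [ht, comp_whiskerRight, comp_whiskerRight, Category.assoc, Category.assoc, h₁]
      _ = φ.hom c a ◁ (α_ _ _ _).hom ≫ φ.hom c a ◁ ψ.hom d c ◁ χ.actCod x₁ x₂ d ≫
            φ.hom c a ◁ K.e ψ χ x₁ c d ≫ t x₁ a c := by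
        rw [associator_naturality_left_assoc, ← whisker_exchange_assoc, ht]
        bicategory
      _ = φ.hom c a ◁ (K.e ψ χ x₂ c d ▷ W.M x₁ x₂ ≫ (K.comp ψ χ).actCod x₁ x₂ c) ≫
            t x₁ a c := by
        rw [h₂]
        bicategory
      _ = _ := by
        rw [Iso.inv_hom_id_assoc, Bicategory.whiskerLeft_comp, Category.assoc]
  actDom x a₂ a₁ c := by
    rw [← cancel_epi (α_ _ _ _).hom]
    refine ((K.isComposite ψ χ).universal x c).whiskerLeft_hom_ext hB _ fun d => ?_
    have h₁ := (K.isBilinear (K.comp φ ψ) χ).actDom x a₂ a₁ d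
    have h₂ := (K.isBilinear φ ψ).actDom d a₂ a₁ c
    calc
      _ = (α_ _ _ _).hom ≫ X.M a₂ a₁ ◁ (φ.hom c a₂ ◁ K.e ψ χ x c d ≫ t x a₂ c) ≫
            (K.comp (K.comp φ ψ) χ).actDom x a₂ a₁ := by bicategory
      _ = (α_ _ _ _).hom ≫ X.M a₂ a₁ ◁ (α_ _ _ _).inv ≫ (α_ _ _ _).inv ≫
            (X.M a₂ a₁ ◁ K.e φ ψ d a₂ c ≫ (K.comp φ ψ).actDom d a₂ a₁) ▷ χ.hom x d ≫
            K.e (K.comp φ ψ) χ x a₁ d := by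
        rw [ht, Bicategory.whiskerLeft_comp, Bicategory.whiskerLeft_comp, Category.assoc,
          Category.assoc, h₁]
        bicategory
      _ = φ.actDom c a₂ a₁ ▷ (ψ.hom d c ≫ χ.hom x d) ≫ φ.hom c a₁ ◁ K.e ψ χ x c d ≫
            t x a₁ c := by
        rw [h₂, ht]
        bicategory
      _ = _ := by
        rw [← whisker_exchange_assoc, Iso.hom_inv_id_assoc]

end DistComposition

namespace DistComposition

variable (K : DistComposition.{s} B) (hB : IsClosedBicategory B) {X Y Z W V : BCat.{s} B}

/-- Left whiskering of a morphism of distributors. -/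
noncomputable def whiskerLeft (φ : Dist X Y) {ψ₁ ψ₂ : Dist Y Z} (g : ψ₁ ⟶ ψ₂) :
    K.comp φ ψ₁ ⟶ K.comp φ ψ₂ :=
  K.desc hB (K.isBilinear_whiskerLeft φ g)

theorem e_whiskerLeft (φ : Dist X Y) {ψ₁ ψ₂ : Dist Y Z} (g : ψ₁ ⟶ ψ₂) (d : Z.carrier)
    (a : X.carrier) (c : Y.carrier) :
    K.e φ ψ₁ d a c ≫ DistHom.app (K.whiskerLeft hB φ g) d a =
      φ.hom c a ◁ DistHom.app g d c ≫ K.e φ ψ₂ d a c :=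
  K.e_desc hB _ d a c

/-- Right whiskering of a morphism of distributors. -/
noncomputable def whiskerRight {φ₁ φ₂ : Dist X Y} (f : φ₁ ⟶ φ₂) (ψ : Dist Y Z) :
    K.comp φ₁ ψ ⟶ K.comp φ₂ ψ :=
  K.desc hB (K.isBilinear_whiskerRight f ψ)

theorem e_whiskerRight {φ₁ φ₂ : Dist X Y} (f : φ₁ ⟶ φ₂) (ψ : Dist Y Z) (d : Z.carrier)
    (a : X.carrier) (c : Y.carrier) :
    K.e φ₁ ψ d a c ≫ DistHom.app (K.whiskerRight hB f ψ) d a =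
      DistHom.app f c a ▷ ψ.hom d c ≫ K.e φ₂ ψ d a c :=
  K.e_desc hB _ d a c

/-- The two descended morphisms act on generators by `α` and by its inverse, so their composites fix
the generators and are identities. -/
theorem exists_associator (hB : IsClosedBicategory B) (φ : Dist X Y) (ψ : Dist Y Z)
    (χ : Dist Z W) :
    ∃ i : K.comp (K.comp φ ψ) χ ≅ K.comp φ (K.comp ψ χ), ∀ x a c d,
      K.e φ ψ d a c ▷ χ.hom x d ≫ K.e (K.comp φ ψ) χ x a d ≫ DistHom.app i.hom x a =
        (α_ _ _ _).hom ≫ φ.hom c a ◁ K.e ψ χ x c d ≫ K.e φ (K.comp ψ χ) x a c := by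
  choose t ht using K.exists_trilinear_left hB φ ψ χ
  choose t' ht' using K.exists_trilinear_right hB φ ψ χ
  refine ⟨⟨K.desc hB (K.isBilinear_trilinear_left hB ht),
    K.desc hB (K.isBilinear_trilinear_right hB ht'), ?_, ?_⟩, fun x a c d => ?_⟩
  · refine hom_ext_left hB fun x a d c => ?_
    rw [comp_app, reassoc_of% K.e_desc, reassoc_of% ht, e_desc, ht', Iso.hom_inv_id_assoc,
      id_app, Category.comp_id]
  · refine hom_ext_right hB fun x a c d => ?_
    rw [comp_app, reassoc_of% K.e_desc, reassoc_of% ht', e_desc, ht, Iso.inv_hom_id_assoc,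
      id_app, Category.comp_id]
  · rw [e_desc, ht]

/-- The associator of distributors. -/
noncomputable def associator (φ : Dist X Y) (ψ : Dist Y Z) (χ : Dist Z W) :
    K.comp (K.comp φ ψ) χ ≅ K.comp φ (K.comp ψ χ) :=
  (K.exists_associator hB φ ψ χ).choose

theorem e_associator (φ : Dist X Y) (ψ : Dist Y Z) (χ : Dist Z W) (x : W.carrier)
    (a : X.carrier) (c : Y.carrier) (d : Z.carrier) :
    K.e φ ψ d a c ▷ χ.hom x d ≫ K.e (K.comp φ ψ) χ x a d ≫
        DistHom.app (K.associator hB φ ψ χ).hom x a =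
      (α_ _ _ _).hom ≫ φ.hom c a ◁ K.e ψ χ x c d ≫ K.e φ (K.comp ψ χ) x a c :=
  (K.exists_associator hB φ ψ χ).choose_spec x a c d

end DistComposition

/-! ### Uniqueness of composites and the unitors. -/

/-- The usual uniqueness of universal objects. It compares the chosen composites with the explicit
ones given by actions (the unitors) and by opposites (the structure of the involution). -/
theorem IsComposite.exists_iso (hB : IsClosedBicategory B) {X Y Z : BCat.{s} B} {φ : Dist X Y}
    {ψ : Dist Y Z} {χ χ' : Dist X Z} {e : ∀ d a c, φ.hom c a ≫ ψ.hom d c ⟶ χ.hom d a}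
    {e' : ∀ d a c, φ.hom c a ≫ ψ.hom d c ⟶ χ'.hom d a}
    (h : IsComposite φ ψ χ e) (h' : IsComposite φ ψ χ' e') :
    ∃ i : χ ≅ χ', ∀ d a c, e d a c ≫ DistHom.app i.hom d a = e' d a c := by
  obtain ⟨f, hf⟩ := h.exists_desc hB h'.isBilinear
  obtain ⟨g, hg⟩ := h'.exists_desc hB h.isBilinear
  refine ⟨⟨f, g, DistHom.ext (funext fun d => funext fun a => (h.universal d a).hom_ext fun c => ?_),
    DistHom.ext (funext fun d => funext fun a => (h'.universal d a).hom_ext fun c => ?_)⟩, hf⟩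
  · rw [comp_app, reassoc_of% hf, hg, id_app, Category.comp_id]
  · rw [comp_app, reassoc_of% hg, hf, id_app, Category.comp_id]

namespace DistComposition

variable (K : DistComposition.{s} B) (hB : IsClosedBicategory B) {X Y Z W V : BCat.{s} B}

/-- The left unitor of distributors. -/
noncomputable def leftUnitor (φ : Dist X Y) : K.comp (idDist X) φ ≅ φ :=
  ((K.isComposite (idDist X) φ).exists_iso hB (isComposite_idDist_left φ)).choose

theorem e_leftUnitor (φ : Dist X Y) (c : Y.carrier) (a a' : X.carrier) :
    K.e (idDist X) φ c a a' ≫ DistHom.app (K.leftUnitor hB φ).hom c a = φ.actDom c a' a :=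
  ((K.isComposite (idDist X) φ).exists_iso hB (isComposite_idDist_left φ)).choose_spec c a a'

/-- The right unitor of distributors. -/
noncomputable def rightUnitor (φ : Dist X Y) : K.comp φ (idDist Y) ≅ φ :=
  ((K.isComposite φ (idDist Y)).exists_iso hB (isComposite_idDist_right φ)).choose

theorem e_rightUnitor (φ : Dist X Y) (c c' : Y.carrier) (a : X.carrier) :
    K.e φ (idDist Y) c a c' ≫ DistHom.app (K.rightUnitor hB φ).hom c a = φ.actCod c c' a :=
  ((K.isComposite φ (idDist Y)).exists_iso hB (isComposite_idDist_right φ)).choose_spec c a c'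

end DistComposition

namespace DistComposition

variable {K : DistComposition.{s} B} (hB : IsClosedBicategory B) {X Y Z W V : BCat.{s} B}

/-! ### The axioms of a bicategory -/

theorem whiskerLeft_id (φ : Dist X Y) (ψ : Dist Y Z) :
    K.whiskerLeft hB φ (𝟙 ψ) = 𝟙 (K.comp φ ψ) :=
  hom_ext fun d a c => by simp [e_whiskerLeft]

theorem whiskerLeft_comp (φ : Dist X Y) {ψ₁ ψ₂ ψ₃ : Dist Y Z} (f : ψ₁ ⟶ ψ₂) (g : ψ₂ ⟶ ψ₃) :
    K.whiskerLeft hB φ (f ≫ g) = K.whiskerLeft hB φ f ≫ K.whiskerLeft hB φ g :=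
  hom_ext fun d a c => by
    rw [e_whiskerLeft, comp_app, comp_app, reassoc_of% K.e_whiskerLeft, e_whiskerLeft,
      Bicategory.whiskerLeft_comp, Category.assoc]

theorem id_whiskerRight (φ : Dist X Y) (ψ : Dist Y Z) :
    K.whiskerRight hB (𝟙 φ) ψ = 𝟙 (K.comp φ ψ) :=
  hom_ext fun d a c => by simp [e_whiskerRight]

theorem comp_whiskerRight {φ₁ φ₂ φ₃ : Dist X Y} (f : φ₁ ⟶ φ₂) (g : φ₂ ⟶ φ₃) (ψ : Dist Y Z) :
    K.whiskerRight hB (f ≫ g) ψ = K.whiskerRight hB f ψ ≫ K.whiskerRight hB g ψ :=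
  hom_ext fun d a c => by
    rw [e_whiskerRight, comp_app, comp_app, reassoc_of% K.e_whiskerRight, e_whiskerRight,
      Bicategory.comp_whiskerRight, Category.assoc]

theorem leftUnitor_naturality {φ ψ : Dist X Y} (f : φ ⟶ ψ) :
    K.whiskerLeft hB (idDist X) f ≫ (K.leftUnitor hB ψ).hom = (K.leftUnitor hB φ).hom ≫ f :=
  hom_ext fun c a a' => by
    rw [comp_app, comp_app, reassoc_of% K.e_whiskerLeft, reassoc_of% K.e_leftUnitor,
      e_leftUnitor]
    exact (f.app_actDom c a' a).symm

theorem rightUnitor_naturality {φ ψ : Dist X Y} (f : φ ⟶ ψ) :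
    K.whiskerRight hB f (idDist Y) ≫ (K.rightUnitor hB ψ).hom = (K.rightUnitor hB φ).hom ≫ f :=
  hom_ext fun c a c' => by
    rw [comp_app, comp_app, reassoc_of% K.e_whiskerRight, reassoc_of% K.e_rightUnitor,
      e_rightUnitor]
    exact (f.app_actCod c c' a).symm

theorem associator_naturality_left {φ φ' : Dist X Y} (f : φ ⟶ φ') (ψ : Dist Y Z)
    (χ : Dist Z W) :
    K.whiskerRight hB (K.whiskerRight hB f ψ) χ ≫ (K.associator hB φ' ψ χ).hom =
      (K.associator hB φ ψ χ).hom ≫ K.whiskerRight hB f (K.comp ψ χ) :=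
  hom_ext_left hB fun x a d c => by
    rw [comp_app, comp_app, reassoc_of% K.e_associator, e_whiskerRight,
      reassoc_of% K.e_whiskerRight, ← Bicategory.comp_whiskerRight_assoc, e_whiskerRight,
      Bicategory.comp_whiskerRight, Category.assoc, e_associator, whisker_exchange_assoc]
    bicategory

theorem associator_naturality_middle (φ : Dist X Y) {ψ ψ' : Dist Y Z} (f : ψ ⟶ ψ')
    (χ : Dist Z W) :
    K.whiskerRight hB (K.whiskerLeft hB φ f) χ ≫ (K.associator hB φ ψ' χ).hom =
      (K.associator hB φ ψ χ).hom ≫ K.whiskerLeft hB φ (K.whiskerRight hB f χ) :=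
  hom_ext_left hB fun x a d c => by
    rw [comp_app, comp_app, reassoc_of% K.e_associator, e_whiskerLeft,
      reassoc_of% K.e_whiskerRight, ← Bicategory.comp_whiskerRight_assoc, e_whiskerLeft,
      Bicategory.comp_whiskerRight, Category.assoc, e_associator,
      ← Bicategory.whiskerLeft_comp_assoc, e_whiskerRight]
    bicategory

theorem associator_naturality_right (φ : Dist X Y) (ψ : Dist Y Z) {χ χ' : Dist Z W}
    (f : χ ⟶ χ') :
    K.whiskerLeft hB (K.comp φ ψ) f ≫ (K.associator hB φ ψ χ').hom =
      (K.associator hB φ ψ χ).hom ≫ K.whiskerLeft hB φ (K.whiskerLeft hB ψ f) :=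
  hom_ext_left hB fun x a d c => by
    rw [comp_app, comp_app, reassoc_of% K.e_associator, e_whiskerLeft,
      reassoc_of% K.e_whiskerLeft, ← whisker_exchange_assoc, e_associator,
      ← Bicategory.whiskerLeft_comp_assoc (φ.hom c a), e_whiskerLeft]
    bicategory

theorem whisker_exchange {φ₁ φ₂ : Dist X Y} {ψ₁ ψ₂ : Dist Y Z} (f : φ₁ ⟶ φ₂) (g : ψ₁ ⟶ ψ₂) :
    K.whiskerLeft hB φ₁ g ≫ K.whiskerRight hB f ψ₂ =
      K.whiskerRight hB f ψ₁ ≫ K.whiskerLeft hB φ₂ g :=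
  hom_ext fun d a c => by
    rw [comp_app, comp_app, reassoc_of% K.e_whiskerLeft, reassoc_of% K.e_whiskerRight,
      e_whiskerLeft, e_whiskerRight, Bicategory.whisker_exchange_assoc]

/-- On generators the two sides are the two legs of the balancing relation of the coend, which is
therefore the whole content of the axiom. -/
theorem triangle (φ : Dist X Y) (ψ : Dist Y Z) :
    (K.associator hB φ (idDist Y) ψ).hom ≫ K.whiskerLeft hB φ (K.leftUnitor hB ψ).hom =
      K.whiskerRight hB (K.rightUnitor hB φ).hom ψ :=
  hom_ext_left hB fun d a c c' => by
    rw [comp_app, reassoc_of% K.e_associator, e_whiskerLeft, e_whiskerRight,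
      ← Bicategory.whiskerLeft_comp_assoc, ← Bicategory.comp_whiskerRight_assoc, e_leftUnitor,
      e_rightUnitor]
    exact (K.cowedge φ ψ d a c c').symm

theorem hom_ext_left₄ (hB : IsClosedBicategory B) {φ : Dist X Y} {ψ : Dist Y Z} {χ : Dist Z W} {ω : Dist W V} {θ : Dist X V}
    {f g : K.comp (K.comp (K.comp φ ψ) χ) ω ⟶ θ}
    (h : ∀ y a x d c, (K.e φ ψ d a c ▷ χ.hom x d) ▷ ω.hom y x ≫
        K.e (K.comp φ ψ) χ x a d ▷ ω.hom y x ≫ K.e (K.comp (K.comp φ ψ) χ) ω y a x ≫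
        DistHom.app f y a =
      (K.e φ ψ d a c ▷ χ.hom x d) ▷ ω.hom y x ≫
        K.e (K.comp φ ψ) χ x a d ▷ ω.hom y x ≫ K.e (K.comp (K.comp φ ψ) χ) ω y a x ≫
        DistHom.app g y a) : f = g :=
  hom_ext_left hB fun y a x d => by
    -- Reassociation joins the two outer 1-cells, so that one whiskering of the innermost coend
    -- suffices.
    rw [← cancel_epi (α_ _ _ _).inv]
    refine ((K.isComposite φ ψ).universal d a).whiskerRight_hom_ext hB _ fun c => ?_
    rw [whiskerRight_comp]
    simp only [Category.assoc, Iso.hom_inv_id_assoc, h]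

theorem pentagon (φ : Dist X Y) (ψ : Dist Y Z) (χ : Dist Z W) (ω : Dist W V) :
    K.whiskerRight hB (K.associator hB φ ψ χ).hom ω ≫
        (K.associator hB φ (K.comp ψ χ) ω).hom ≫
        K.whiskerLeft hB φ (K.associator hB ψ χ ω).hom =
      (K.associator hB (K.comp φ ψ) χ ω).hom ≫ (K.associator hB φ ψ (K.comp χ ω)).hom :=
  hom_ext_left₄ hB fun y a x d c => by
    calc
      _ = (K.e φ ψ d a c ▷ χ.hom x d ≫ K.e (K.comp φ ψ) χ x a d ≫
              DistHom.app (K.associator hB φ ψ χ).hom x a) ▷ ω.hom y x ≫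
            K.e _ ω y a x ≫ DistHom.app (K.associator hB φ (K.comp ψ χ) ω).hom y a ≫
            DistHom.app (K.whiskerLeft hB φ (K.associator hB ψ χ ω).hom) y a := by
        rw [comp_app, comp_app, reassoc_of% K.e_whiskerRight]
        simp only [Bicategory.comp_whiskerRight, Category.assoc]
      _ = (α_ _ _ _).hom ▷ _ ≫ (α_ _ _ _).hom ≫ φ.hom c a ◁ (K.e ψ χ x c d ▷ ω.hom y x ≫
            K.e (K.comp ψ χ) ω y c x ≫ DistHom.app (K.associator hB ψ χ ω).hom y c) ≫
            K.e φ _ y a c := by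
        rw [e_associator]
        simp only [Bicategory.comp_whiskerRight, Category.assoc]
        rw [reassoc_of% K.e_associator, e_whiskerLeft]
        bicategory
      -- The pentagon of `B` is used here: this is the common form to which both sides reduce on
      -- generators.
      _ = (α_ _ _ _).hom ≫ (α_ _ _ _).hom ≫
            φ.hom c a ◁ ψ.hom d c ◁ K.e χ ω y d x ≫ φ.hom c a ◁ K.e ψ _ y c d ≫
            K.e φ _ y a c := by
        rw [e_associator]
        bicategory
      _ = (α_ _ _ _).hom ≫ K.e φ ψ d a c ▷ (χ.hom x d ≫ ω.hom y x) ≫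
            (K.comp φ ψ).hom d a ◁ K.e χ ω y d x ≫ K.e (K.comp φ ψ) _ y a d ≫
            DistHom.app (K.associator hB φ ψ (K.comp χ ω)).hom y a := by
        rw [← Bicategory.whisker_exchange_assoc, e_associator]
        bicategory
      _ = _ := by
        rw [comp_app, reassoc_of% K.e_associator (φ := K.comp φ ψ)]
        simp

end DistComposition

/-- The bicategory structure on enriched categories, distributors and their morphisms, for a
choice of composites. -/
noncomputable def distBicategoryOn (K : DistComposition.{s} B) (hB : IsClosedBicategory B) :
    DistBicategoryOn K where
  whiskerLeft φ _ _ g := K.whiskerLeft hB φ g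
  whiskerRight f ψ := K.whiskerRight hB f ψ
  associator φ ψ χ := K.associator hB φ ψ χ
  leftUnitor φ := K.leftUnitor hB φ
  rightUnitor φ := K.rightUnitor hB φ
  whiskerLeft_id φ ψ := DistComposition.whiskerLeft_id hB φ ψ
  whiskerLeft_comp φ _ _ _ f g := DistComposition.whiskerLeft_comp hB φ f g
  -- This axiom and the similar ones below are naturality squares of the unitors and of the
  -- associator, solved for the whiskered morphism.
  id_whiskerLeft {_ _ _ ψ} f := (Iso.eq_comp_inv (K.leftUnitor hB ψ)).2
    (DistComposition.leftUnitor_naturality hB f) |>.trans (Category.assoc _ _ _)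
  comp_whiskerLeft {_ _ _ _} φ ψ {_ χ'} f := (Iso.eq_comp_inv (K.associator hB φ ψ χ')).2
    (DistComposition.associator_naturality_right hB φ ψ f) |>.trans (Category.assoc _ _ _)
  id_whiskerRight φ ψ := DistComposition.id_whiskerRight hB φ ψ
  comp_whiskerRight f g ψ := DistComposition.comp_whiskerRight hB f g ψ
  whiskerRight_id {_ _ _ ψ} f := (Iso.eq_comp_inv (K.rightUnitor hB ψ)).2
    (DistComposition.rightUnitor_naturality hB f) |>.trans (Category.assoc _ _ _)
  whiskerRight_comp {_ _ _ _ φ _} f ψ χ := (Iso.eq_inv_comp (K.associator hB φ ψ χ)).2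
    (DistComposition.associator_naturality_left hB f ψ χ).symm
  whisker_assoc {_ _ _ _} φ {_ ψ'} f χ := (Iso.eq_comp_inv (K.associator hB φ ψ' χ)).2
    (DistComposition.associator_naturality_middle hB φ f χ) |>.trans (Category.assoc _ _ _)
  whisker_exchange f g := DistComposition.whisker_exchange hB f g
  pentagon φ ψ χ ω := DistComposition.pentagon hB φ ψ χ ω
  triangle φ ψ := DistComposition.triangle hB φ ψ

theorem distBicategoryOn_isCanonical (K : DistComposition.{s} B) (hB : IsClosedBicategory B) :
    (distBicategoryOn K hB).IsCanonical where
  whiskerLeft_app φ _ _ g d a c := K.e_whiskerLeft hB φ g d a c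
  whiskerRight_app f ψ d a c := K.e_whiskerRight hB f ψ d a c
  associator_app φ ψ χ x a c d := K.e_associator hB φ ψ χ x a c d
  leftUnitor_app φ c a a' := K.e_leftUnitor hB φ c a a'
  rightUnitor_app φ c c' a := K.e_rightUnitor hB φ c c' a

/-! ### Involutions on the base bicategory -/

namespace Involution

variable (I : Involution B)

theorem inv₂_eqToHom {x y : B} {f g : x ⟶ y} (h : f = g) :
    I.inv₂ (eqToHom h) = eqToHom (congrArg I.inv h) := by
  subst h
  exact I.inv₂_id f

/-- The transpose of a 2-cell `f° ⟹ g` along the involution. -/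
theorem existsUnique_transpose {x y : B} {f : x ⟶ y} {g : y ⟶ x} (h : I.inv f ⟶ g) :
    ∃! k : f ⟶ I.inv g, I.inv₂ k ≫ eqToHom (I.inv_inv g) = h := by
  refine ⟨eqToHom (I.inv_inv f).symm ≫ I.inv₂ h, ?_, fun k hk => ?_⟩
  · simp [I.inv₂_comp, I.inv₂_eqToHom, I.inv₂_inv₂]
  · subst hk
    simp [I.inv₂_comp, I.inv₂_eqToHom, I.inv₂_inv₂]

theorem invComp_assoc_inv {x y z t : B} (f : x ⟶ y) (g : y ⟶ z) (h : z ⟶ t) :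
    (I.invComp g h).hom ▷ I.inv f ≫ (I.invComp f (g ≫ h)).hom ≫ I.inv₂ (α_ f g h).inv =
      (α_ (I.inv h) (I.inv g) (I.inv f)).hom ≫ I.inv h ◁ (I.invComp f g).hom ≫
        (I.invComp (f ≫ g) h).hom := by
  have h₁ := I.invComp_assoc f g h
  have h₂ : I.inv₂ (α_ f g h).hom ≫ I.inv₂ (α_ f g h).inv = 𝟙 _ := by
    rw [← I.inv₂_comp, Iso.hom_inv_id, I.inv₂_id]
  rw [← cancel_epi (α_ (I.inv h) (I.inv g) (I.inv f)).inv, Iso.inv_hom_id_assoc,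
    ← reassoc_of% h₁, h₂, Category.comp_id]

end Involution

/-! ### The opposite of a distributor -/

namespace IsSymmetric

variable {I : Involution B} {X : BCat.{s} B} (hX : IsSymmetric I X)

/-- The structural isomorphism `M(a,b) = M(b,a)°` of a symmetric enriched category. -/
abbrev cell (a b : X.carrier) : X.M a b ⟶ I.inv (X.M b a) :=
  eqToHom (hX.M_eq a b)

theorem ρ_cell (a : X.carrier) :
    X.ρ a ≫ hX.cell a a = (I.invId (X.typ a)).hom ≫ I.inv₂ (X.ρ a) :=
  (hX.ρ_eq a).symm

/-- The symmetry axiom is solved for `ι` followed by the transport. From here on `cell` can be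
treated as an ordinary 2-cell. -/
theorem ι_cell (a b c : X.carrier) :
    X.ι a b c ≫ hX.cell a c = hX.cell b c ▷ X.M a b ≫ I.inv (X.M c b) ◁ hX.cell a b ≫
      (I.invComp (X.M b a) (X.M c b)).hom ≫ I.inv₂ (X.ι c b a) := by
  rw [hX.ι_eq c b a, eqToHom_whiskerRight, whiskerLeft_eqToHom]
  simp

end IsSymmetric

section Opposite

variable {I : Involution B} {X Y Z : BCat.{s} B} (hX : IsSymmetric I X) (hY : IsSymmetric I Y)
  (hZ : IsSymmetric I Z)

/-- The codomain action of the opposite of a distributor. -/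
def oppCod (φ : Dist X Y) (a a' : X.carrier) (c : Y.carrier) :
    I.inv (φ.hom c a') ≫ X.M a a' ⟶ I.inv (φ.hom c a) :=
  I.inv (φ.hom c a') ◁ hX.cell a a' ≫ (I.invComp (X.M a' a) (φ.hom c a')).hom ≫
    I.inv₂ (φ.actDom c a' a)

/-- The domain action of the opposite of a distributor. -/
def oppDom (φ : Dist X Y) (a : X.carrier) (c' c : Y.carrier) :
    Y.M c' c ≫ I.inv (φ.hom c' a) ⟶ I.inv (φ.hom c a) :=
  hY.cell c' c ▷ I.inv (φ.hom c' a) ≫ (I.invComp (φ.hom c' a) (Y.M c c')).hom ≫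
    I.inv₂ (φ.actCod c c' a)

/-- The involution reverses 1-cells, so the unit law for the domain action of `φ` becomes the one
for the codomain action of its opposite. Symmetry of `ρ` brings the unit into the required form. -/
theorem oppCod_unit (φ : Dist X Y) (a : X.carrier) (c : Y.carrier) :
    I.inv (φ.hom c a) ◁ X.ρ a ≫ oppCod hX φ a a c = (ρ_ _).hom := by
  rw [oppCod, ← Bicategory.whiskerLeft_comp_assoc, hX.ρ_cell, Bicategory.whiskerLeft_comp,
    Category.assoc, reassoc_of% I.invComp_naturality_left, ← I.inv₂_comp, φ.actDom_unit,
    I.invComp_id_left]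

theorem oppDom_unit (φ : Dist X Y) (a : X.carrier) (c : Y.carrier) :
    Y.ρ c ▷ I.inv (φ.hom c a) ≫ oppDom hY φ a c c = (λ_ _).hom := by
  rw [oppDom, ← comp_whiskerRight_assoc, hY.ρ_cell, comp_whiskerRight,
    Category.assoc, reassoc_of% I.invComp_naturality_right, ← I.inv₂_comp, φ.actCod_unit,
    I.invComp_id_right]

/-- The image of the associativity of the domain action of `φ`, with `ι` transferred by symmetry and
the bracketings matched by the coherence of `invComp`. -/
theorem oppCod_assoc (φ : Dist X Y) (a₁ a₂ a₃ : X.carrier) (c : Y.carrier) :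
    oppCod hX φ a₂ a₃ c ▷ X.M a₁ a₂ ≫ oppCod hX φ a₁ a₂ c =
      (α_ _ _ _).hom ≫ I.inv (φ.hom c a₃) ◁ X.ι a₁ a₂ a₃ ≫ oppCod hX φ a₁ a₃ c := by
  calc
    _ = (I.inv (φ.hom c a₃) ◁ hX.cell a₂ a₃) ▷ X.M a₁ a₂ ≫ _ ◁ hX.cell a₁ a₂ ≫
          (I.invComp (X.M a₃ a₂) (φ.hom c a₃)).hom ▷ _ ≫
          I.inv₂ (φ.actDom c a₃ a₂) ▷ I.inv (X.M a₂ a₁) ≫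
          (I.invComp (X.M a₂ a₁) (φ.hom c a₂)).hom ≫ I.inv₂ (φ.actDom c a₂ a₁) := by
      rw [oppCod, oppCod, comp_whiskerRight, comp_whiskerRight, Category.assoc, Category.assoc,
        ← whisker_exchange_assoc, ← whisker_exchange_assoc]
    _ = (I.inv (φ.hom c a₃) ◁ hX.cell a₂ a₃) ▷ X.M a₁ a₂ ≫ _ ◁ hX.cell a₁ a₂ ≫
          ((I.invComp (X.M a₃ a₂) (φ.hom c a₃)).hom ▷ I.inv (X.M a₂ a₁) ≫
          (I.invComp (X.M a₂ a₁) (X.M a₃ a₂ ≫ φ.hom c a₃)).hom ≫ I.inv₂ (α_ _ _ _).inv) ≫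
          I.inv₂ (X.ι a₃ a₂ a₁ ▷ φ.hom c a₃ ≫ φ.actDom c a₃ a₁) := by
      rw [reassoc_of% I.invComp_naturality_right, ← I.inv₂_comp, φ.actDom_assoc, I.inv₂_comp]
      simp only [Category.assoc]
    _ = (I.inv (φ.hom c a₃) ◁ hX.cell a₂ a₃) ▷ X.M a₁ a₂ ≫ _ ◁ hX.cell a₁ a₂ ≫
          (α_ _ _ _).hom ≫ I.inv (φ.hom c a₃) ◁ ((I.invComp (X.M a₂ a₁) (X.M a₃ a₂)).hom ≫
            I.inv₂ (X.ι a₃ a₂ a₁)) ≫ (I.invComp (X.M a₃ a₁) (φ.hom c a₃)).hom ≫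
          I.inv₂ (φ.actDom c a₃ a₁) := by
      rw [I.invComp_assoc_inv, I.inv₂_comp, Bicategory.whiskerLeft_comp, Category.assoc,
        Category.assoc, Category.assoc, reassoc_of% I.invComp_naturality_left]
    _ = (α_ _ _ _).hom ≫ I.inv (φ.hom c a₃) ◁ (X.ι a₁ a₂ a₃ ≫ hX.cell a₁ a₃) ≫
          (I.invComp (X.M a₃ a₁) (φ.hom c a₃)).hom ≫ I.inv₂ (φ.actDom c a₃ a₁) := by
      rw [hX.ι_cell]
      bicategory
    _ = _ := by
      rw [oppCod, Bicategory.whiskerLeft_comp, Category.assoc]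

theorem oppDom_assoc (φ : Dist X Y) (a : X.carrier) (c₁ c₂ c₃ : Y.carrier) :
    Y.M c₂ c₁ ◁ oppDom hY φ a c₃ c₂ ≫ oppDom hY φ a c₂ c₁ =
      (α_ _ _ _).inv ≫ Y.ι c₃ c₂ c₁ ▷ I.inv (φ.hom c₃ a) ≫ oppDom hY φ a c₃ c₁ := by
  calc
    _ = Y.M c₂ c₁ ◁ (hY.cell c₃ c₂ ▷ I.inv (φ.hom c₃ a)) ≫ hY.cell c₂ c₁ ▷ _ ≫
          _ ◁ (I.invComp (φ.hom c₃ a) (Y.M c₂ c₃)).hom ≫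
          I.inv (Y.M c₁ c₂) ◁ I.inv₂ (φ.actCod c₂ c₃ a) ≫
          (I.invComp (φ.hom c₂ a) (Y.M c₁ c₂)).hom ≫ I.inv₂ (φ.actCod c₁ c₂ a) := by
      rw [oppDom, oppDom, Bicategory.whiskerLeft_comp, Bicategory.whiskerLeft_comp,
        Category.assoc, Category.assoc, whisker_exchange_assoc, whisker_exchange_assoc]
    _ = Y.M c₂ c₁ ◁ (hY.cell c₃ c₂ ▷ I.inv (φ.hom c₃ a)) ≫ hY.cell c₂ c₁ ▷ _ ≫
          (I.inv (Y.M c₁ c₂) ◁ (I.invComp (φ.hom c₃ a) (Y.M c₂ c₃)).hom ≫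
          (I.invComp (φ.hom c₃ a ≫ Y.M c₂ c₃) (Y.M c₁ c₂)).hom ≫ I.inv₂ (α_ _ _ _).hom) ≫
          I.inv₂ (φ.hom c₃ a ◁ Y.ι c₁ c₂ c₃ ≫ φ.actCod c₁ c₃ a) := by
      rw [reassoc_of% I.invComp_naturality_left, ← I.inv₂_comp, φ.actCod_assoc, I.inv₂_comp]
      simp only [Category.assoc]
    _ = Y.M c₂ c₁ ◁ (hY.cell c₃ c₂ ▷ I.inv (φ.hom c₃ a)) ≫ hY.cell c₂ c₁ ▷ _ ≫
          (α_ _ _ _).inv ≫ ((I.invComp (Y.M c₂ c₃) (Y.M c₁ c₂)).hom ≫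
            I.inv₂ (Y.ι c₁ c₂ c₃)) ▷ I.inv (φ.hom c₃ a) ≫
          (I.invComp (φ.hom c₃ a) (Y.M c₁ c₃)).hom ≫ I.inv₂ (φ.actCod c₁ c₃ a) := by
      rw [I.invComp_assoc, I.inv₂_comp, comp_whiskerRight, Category.assoc,
        Category.assoc, Category.assoc, reassoc_of% I.invComp_naturality_right]
    _ = (α_ _ _ _).inv ≫ (Y.ι c₃ c₂ c₁ ≫ hY.cell c₃ c₁) ▷ I.inv (φ.hom c₃ a) ≫
          (I.invComp (φ.hom c₃ a) (Y.M c₁ c₃)).hom ≫ I.inv₂ (φ.actCod c₁ c₃ a) := by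
      rw [hY.ι_cell, ← whisker_exchange_assoc]
      bicategory
    _ = _ := by
      rw [oppDom, comp_whiskerRight, Category.assoc]

/-- The double action of the opposite is computed as the image of `δ`. Together with the computation
in the other order, this shows that the opposite actions commute. -/
theorem whiskerLeft_oppCod_comp_oppDom (φ : Dist X Y) (a a' : X.carrier) (c' c : Y.carrier) :
    Y.M c' c ◁ oppCod hX φ a a' c' ≫ oppDom hY φ a c' c =
      Y.M c' c ◁ I.inv (φ.hom c' a') ◁ hX.cell a a' ≫ hY.cell c' c ▷ _ ≫
        I.invComp₃ (X.M a' a) (φ.hom c' a') (Y.M c c') ≫ I.inv₂ (φ.δ c c' a' a) := by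
  calc
    _ = Y.M c' c ◁ I.inv (φ.hom c' a') ◁ hX.cell a a' ≫ hY.cell c' c ▷ _ ≫
          _ ◁ (I.invComp (X.M a' a) (φ.hom c' a')).hom ≫
          I.inv (Y.M c c') ◁ I.inv₂ (φ.actDom c' a' a) ≫
          (I.invComp (φ.hom c' a) (Y.M c c')).hom ≫ I.inv₂ (φ.actCod c c' a) := by
      rw [oppDom, oppCod, Bicategory.whiskerLeft_comp, Bicategory.whiskerLeft_comp,
        Category.assoc, Category.assoc, whisker_exchange_assoc, whisker_exchange_assoc]
    _ = _ := by
      rw [reassoc_of% I.invComp_naturality_left, ← I.inv₂_comp,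
        φ.actDom_whiskerRight_comp_actCod, I.inv₂_comp, reassoc_of% I.invComp_assoc,
        Involution.invComp₃]
      simp only [Category.assoc]

theorem oppDom_whiskerRight_comp_oppCod (φ : Dist X Y) (a a' : X.carrier) (c' c : Y.carrier) :
    oppDom hY φ a' c' c ▷ X.M a a' ≫ oppCod hX φ a a' c =
      (α_ _ _ _).hom ≫ Y.M c' c ◁ I.inv (φ.hom c' a') ◁ hX.cell a a' ≫ hY.cell c' c ▷ _ ≫
        I.invComp₃ (X.M a' a) (φ.hom c' a') (Y.M c c') ≫ I.inv₂ (φ.δ c c' a' a) := by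
  calc
    _ = (hY.cell c' c ▷ I.inv (φ.hom c' a')) ▷ X.M a a' ≫ _ ◁ hX.cell a a' ≫
          (I.invComp (φ.hom c' a') (Y.M c c')).hom ▷ _ ≫
          I.inv₂ (φ.actCod c c' a') ▷ I.inv (X.M a' a) ≫
          (I.invComp (X.M a' a) (φ.hom c a')).hom ≫ I.inv₂ (φ.actDom c a' a) := by
      rw [oppDom, oppCod, comp_whiskerRight, comp_whiskerRight, Category.assoc, Category.assoc,
        ← whisker_exchange_assoc, ← whisker_exchange_assoc]
    _ = (hY.cell c' c ▷ I.inv (φ.hom c' a')) ▷ X.M a a' ≫ _ ◁ hX.cell a a' ≫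
          (I.invComp (φ.hom c' a') (Y.M c c')).hom ▷ _ ≫
          (I.invComp (X.M a' a) (φ.hom c' a' ≫ Y.M c c')).hom ≫ I.inv₂ (φ.δ c c' a' a) := by
      rw [reassoc_of% I.invComp_naturality_right, ← I.inv₂_comp,
        φ.whiskerLeft_actCod_comp_actDom]
    _ = _ := by
      rw [Involution.invComp₃, whisker_exchange_assoc (hY.cell c' c)]
      bicategory

/-- The opposite `φ°` of a distributor between symmetric enriched categories. -/
@[reducible]
def opp (φ : Dist X Y) : Dist Y X :=
  Dist.ofActions (fun a c => I.inv (φ.hom c a)) (oppCod hX φ) (oppDom hY φ)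
    (oppCod_unit hX φ) (oppDom_unit hY φ) (oppCod_assoc hX φ) (oppDom_assoc hY φ) (by
      intro a a' c' c
      rw [oppDom_whiskerRight_comp_oppCod hX hY, whiskerLeft_oppCod_comp_oppDom hX hY,
        Iso.inv_hom_id_assoc])

theorem opp_actCod (φ : Dist X Y) : (opp hX hY φ).actCod = oppCod hX φ :=
  Dist.ofActions_actCod ..

theorem opp_actDom (φ : Dist X Y) : (opp hX hY φ).actDom = oppDom hY φ :=
  Dist.ofActions_actDom ..

theorem opp_isOpposite (φ : Dist X Y) : IsOpposite I hX hY φ (opp hX hY φ) where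
  hom_eq _ _ := rfl
  δ_eq a₁ a₂ c₂ c₁ := by
    refine (Category.comp_id _).trans ?_
    refine (whiskerLeft_oppCod_comp_oppDom hX hY φ a₁ a₂ c₂ c₁).trans ?_
    rw [whiskerLeft_eqToHom, whiskerLeft_eqToHom, eqToHom_whiskerRight, eqToHom_trans_assoc]

end Opposite

/-! ### Isomorphisms and strict equalities of distributors. -/

section Isomorphisms

variable {X Y : BCat.{s} B} {φ ψ : Dist X Y}

/-- A morphism of distributors with invertible components is an isomorphism. -/
def isoOfComponents (f : φ ⟶ ψ) (i : ∀ c a, φ.hom c a ≅ ψ.hom c a)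
    (h : ∀ c a, (i c a).hom = DistHom.app f c a) : φ ≅ ψ where
  hom := f
  inv :=
    { app := fun c a => (i c a).inv
      app_actCod := fun c₁ c₂ a => by
        rw [Iso.comp_inv_eq, Category.assoc, h, DistHom.app_actCod, ← h,
          inv_hom_whiskerRight_assoc]
      app_actDom := fun c a₁ a₂ => by
        rw [Iso.comp_inv_eq, Category.assoc, h, DistHom.app_actDom, ← h,
          whiskerLeft_inv_hom_assoc] }
  hom_inv_id := DistHom.ext (funext fun c => funext fun a => by
    rw [comp_app, ← h]
    exact (i c a).hom_inv_id)
  inv_hom_id := DistHom.ext (funext fun c => funext fun a => by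
    rw [comp_app, ← h]
    exact (i c a).inv_hom_id)

/-- A morphism commutes with both actions, hence with `δ`. When its components are transports, this
says exactly that the double actions agree once the 1-cells are identified, so no heterogeneous
equality arises. -/
theorem Dist.eq_of_hom (f : φ ⟶ ψ) (h : ∀ c a, φ.hom c a = ψ.hom c a)
    (hf : ∀ c a, DistHom.app f c a = eqToHom (h c a)) : φ = ψ := by
  have hδ : ∀ c c' a' a, φ.δ c c' a' a ≫ DistHom.app f c a =
      X.M a' a ◁ (DistHom.app f c' a' ▷ Y.M c c') ≫ ψ.δ c c' a' a := fun c c' a' a => by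
    rw [← φ.whiskerLeft_actCod_comp_actDom, ← ψ.whiskerLeft_actCod_comp_actDom, Category.assoc,
      DistHom.app_actDom, ← Bicategory.whiskerLeft_comp_assoc, DistHom.app_actCod]
    simp only [Bicategory.whiskerLeft_comp, Category.assoc]
  simp only [hf] at hδ
  clear hf f
  obtain ⟨h₁, δ₁, _, _⟩ := φ
  obtain ⟨h₂, δ₂, _, _⟩ := ψ
  obtain rfl : h₁ = h₂ := funext fun c => funext fun a => h c a
  congr 1
  funext c c' a' a
  simpa using hδ c c' a' a

theorem eqToHom_app (h : φ = ψ) (c : Y.carrier) (a : X.carrier) :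
    DistHom.app (eqToHom h) c a = eqToHom (congrArg (fun χ : Dist X Y => χ.hom c a) h) := by
  subst h
  rfl

end Isomorphisms

/-- An involution preserves universal families. -/
theorem IsUniversalFamily.inv₂ (I : Involution B) {ι κ : Type*} {σ τ : κ → ι} {x y : B}
    {P : ι → (x ⟶ y)} {Q : κ → (x ⟶ y)} {l : ∀ j, Q j ⟶ P (σ j)} {r : ∀ j, Q j ⟶ P (τ j)}
    {w : x ⟶ y} {e : ∀ i, P i ⟶ w} (h : IsUniversalFamily l r e) :
    IsUniversalFamily (P := fun i => I.inv (P i)) (Q := fun j => I.inv (Q j)) (σ := σ) (τ := τ)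
      (fun j => I.inv₂ (l j)) (fun j => I.inv₂ (r j)) (fun i => I.inv₂ (e i)) := by
  refine ⟨fun j => ?_, fun w' f hf => ?_⟩
  · rw [← I.inv₂_comp, h.condition, I.inv₂_comp]
  · choose g hg _ using fun i => I.existsUnique_transpose (f i)
    have ext : ∀ {f : x ⟶ y} {k l : f ⟶ I.inv w'},
        I.inv₂ k ≫ eqToHom (I.inv_inv w') = I.inv₂ l ≫ eqToHom (I.inv_inv w') → k = l :=
      fun {_ _ _} h => (I.existsUnique_transpose _).unique h rfl
    obtain ⟨k, hk, hk'⟩ := h.existsUnique (I.inv w') g fun j => ext (by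
      simp only [I.inv₂_comp, Category.assoc, hg, hf])
    refine ⟨I.inv₂ k ≫ eqToHom (I.inv_inv w'), fun i => ?_, fun l hl => ?_⟩
    · rw [← hg, ← hk, I.inv₂_comp, Category.assoc]
    · obtain ⟨l', rfl, -⟩ := I.existsUnique_transpose l
      rw [hk' l' fun i => ext ?_]
      rw [hg, ← hl i, I.inv₂_comp, Category.assoc]

/-! ### Functoriality of the opposite and its effect on identities and composites. -/

section Opposite

variable {I : Involution B} {X Y Z : BCat.{s} B} (hX : IsSymmetric I X) (hY : IsSymmetric I Y)
  (hZ : IsSymmetric I Z)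

/-- The opposite of a morphism of distributors. -/
@[reducible]
def oppMap {φ₁ φ₂ : Dist X Y} (f : φ₁ ⟶ φ₂) : opp hX hY φ₁ ⟶ opp hX hY φ₂ where
  app a c := I.inv₂ (DistHom.app f c a)
  app_actCod a₁ a₂ c := by
    rw [opp_actCod, opp_actCod]
    change oppCod hX φ₁ a₁ a₂ c ≫ _ = I.inv₂ (DistHom.app f c a₂) ▷ X.M a₁ a₂ ≫ oppCod hX φ₂ a₁ a₂ c
    rw [oppCod, oppCod, Category.assoc, Category.assoc, ← I.inv₂_comp, DistHom.app_actDom,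
      I.inv₂_comp, ← reassoc_of% I.invComp_naturality_right, whisker_exchange_assoc]
  app_actDom a c₁ c₂ := by
    rw [opp_actDom, opp_actDom]
    change oppDom hY φ₁ a c₁ c₂ ≫ _ = Y.M c₁ c₂ ◁ I.inv₂ (DistHom.app f c₁ a) ≫ oppDom hY φ₂ a c₁ c₂
    rw [oppDom, oppDom, Category.assoc, Category.assoc, ← I.inv₂_comp, DistHom.app_actCod,
      I.inv₂_comp, ← reassoc_of% I.invComp_naturality_left, whisker_exchange_assoc]

@[simp]
theorem oppMap_app {φ₁ φ₂ : Dist X Y} (f : φ₁ ⟶ φ₂) (a : X.carrier) (c : Y.carrier) :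
    DistHom.app (oppMap hX hY f) a c = I.inv₂ (DistHom.app f c a) := rfl

/-- The comparison of an identity distributor with its opposite. -/
@[reducible]
def oppIdHom : idDist X ⟶ opp hX hX (idDist X) where
  app a a' := hX.cell a a'
  app_actCod a₁ a₂ a := by
    rw [opp_actCod, idDist_actCod]
    change X.ι a₁ a₂ a ≫ _ = hX.cell a₂ a ▷ X.M a₁ a₂ ≫ oppCod hX (idDist X) a₁ a₂ a
    rw [oppCod, idDist_actDom]
    exact hX.ι_cell a₁ a₂ a
  app_actDom a a₁ a₂ := by
    rw [opp_actDom, idDist_actDom]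
    change X.ι a a₁ a₂ ≫ _ = X.M a₁ a₂ ◁ hX.cell a a₁ ≫ oppDom hX (idDist X) a a₁ a₂
    rw [oppDom, idDist_actCod]
    refine (hX.ι_cell a a₁ a₂).trans ?_
    rw [← whisker_exchange_assoc]
    rfl

/-- An identity distributor is isomorphic to its opposite. -/
def oppId : idDist X ≅ opp hX hX (idDist X) :=
  isoOfComponents (oppIdHom hX) (fun a a' => eqToIso (hX.M_eq a a')) fun _ _ => rfl

theorem oppId_hom_app (a a' : X.carrier) :
    DistHom.app (oppId hX).hom a a' = eqToHom (hX.M_eq a a') := rfl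

/-! ### The opposite of a composite -/

/-- The comparison of the two bracketings used to compare balanced families and their opposites. -/
def oppCell (φ : Dist X Y) (ψ : Dist Y Z) (d : Z.carrier) (a : X.carrier) (c₁ c₂ : Y.carrier) :
    (I.inv (ψ.hom d c₁) ≫ Y.M c₂ c₁) ≫ I.inv (φ.hom c₂ a) ≅
      I.inv ((φ.hom c₂ a ≫ Y.M c₁ c₂) ≫ ψ.hom d c₁) :=
  α_ _ _ _ ≪≫ whiskerLeftIso _ (whiskerRightIso (eqToIso (hY.M_eq c₂ c₁)) _) ≪≫
    whiskerLeftIso _ (I.invComp (φ.hom c₂ a) (Y.M c₁ c₂)) ≪≫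
    I.invComp (φ.hom c₂ a ≫ Y.M c₁ c₂) (ψ.hom d c₁)

/-- Together with its companion, this identifies the two legs of the balancing relation for the
opposites with images of the original legs, up to the invertible `oppCell`. -/
theorem oppCell_comp_left (φ : Dist X Y) (ψ : Dist Y Z) (d : Z.carrier) (a : X.carrier)
    (c₁ c₂ : Y.carrier) :
    (α_ _ _ _).hom ≫ I.inv (ψ.hom d c₁) ◁ oppDom hY φ a c₂ c₁ ≫
        (I.invComp (φ.hom c₁ a) (ψ.hom d c₁)).hom =
      (oppCell hY φ ψ d a c₁ c₂).hom ≫ I.inv₂ (φ.actCod c₁ c₂ a ▷ ψ.hom d c₁) := by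
  simp only [oppDom, Bicategory.whiskerLeft_comp, Category.assoc]
  rw [I.invComp_naturality_left]
  simp [oppCell]

theorem oppCell_comp_right (φ : Dist X Y) (ψ : Dist Y Z) (d : Z.carrier) (a : X.carrier)
    (c₁ c₂ : Y.carrier) :
    oppCod hY ψ c₂ c₁ d ▷ I.inv (φ.hom c₂ a) ≫ (I.invComp (φ.hom c₂ a) (ψ.hom d c₂)).hom =
      (oppCell hY φ ψ d a c₁ c₂).hom ≫
        I.inv₂ ((α_ _ _ _).hom ≫ φ.hom c₂ a ◁ ψ.actDom d c₁ c₂) := by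
  simp only [oppCod, comp_whiskerRight, Category.assoc]
  rw [I.invComp_naturality_right, I.inv₂_comp]
  simp only [oppCell, Iso.trans_hom, whiskerLeftIso_hom, whiskerRightIso_hom, Category.assoc]
  rw [reassoc_of% I.invComp_assoc]
  simp only [eqToIso.hom]
  bicategory

theorem isCowedge_opp_iff {φ : Dist X Y} {ψ : Dist Y Z} {d : Z.carrier} {a : X.carrier}
    {w : Z.typ d ⟶ X.typ a} {f : ∀ c, I.inv (φ.hom c a ≫ ψ.hom d c) ⟶ w} :
    IsCowedge (opp hY hZ ψ) (opp hX hY φ) a d w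
        (fun c => (I.invComp (φ.hom c a) (ψ.hom d c)).hom ≫ f c) ↔
      ∀ c₁ c₂, I.inv₂ (φ.actCod c₁ c₂ a ▷ ψ.hom d c₁) ≫ f c₁ =
        I.inv₂ ((α_ _ _ _).hom ≫ φ.hom c₂ a ◁ ψ.actDom d c₁ c₂) ≫ f c₂ := by
  -- Reversal exchanges the two legs of the relation, so the indices are swapped here and the sides
  -- of the equation at the end.
  refine Iff.trans ⟨fun h c₁ c₂ => h c₂ c₁, fun h c₁ c₂ => h c₂ c₁⟩
    (forall₂_congr fun c₁ c₂ => ?_)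
  rw [opp_actCod, opp_actDom, ← cancel_epi (oppCell hY φ ψ d a c₁ c₂).hom,
    ← reassoc_of% oppCell_comp_left, ← reassoc_of% oppCell_comp_right]
  exact eq_comm

theorem isUniversalCowedge_opp {φ : Dist X Y} {ψ : Dist Y Z} {d : Z.carrier} {a : X.carrier}
    {w : X.typ a ⟶ Z.typ d} {e : ∀ c, φ.hom c a ≫ ψ.hom d c ⟶ w}
    (h : IsUniversalCowedge φ ψ d a w e) :
    IsUniversalCowedge (opp hY hZ ψ) (opp hX hY φ) a d (I.inv w)
      (fun c => (I.invComp (φ.hom c a) (ψ.hom d c)).hom ≫ I.inv₂ (e c)) := by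
  refine ⟨(isCowedge_opp_iff hX hY hZ).2 fun c₁ c₂ => ?_, fun w' e' he' => ?_⟩
  · rw [← I.inv₂_comp, ← I.inv₂_comp, h.isCowedge, Category.assoc]
  · obtain ⟨f, rfl⟩ : ∃ f : ∀ c, I.inv (φ.hom c a ≫ ψ.hom d c) ⟶ w',
        e' = fun c => (I.invComp (φ.hom c a) (ψ.hom d c)).hom ≫ f c :=
      ⟨fun c => (I.invComp (φ.hom c a) (ψ.hom d c)).inv ≫ e' c, by
        funext c
        exact (Iso.hom_inv_id_assoc _ _).symm⟩
    replace he' := (isCowedge_opp_iff hX hY hZ).1 he'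
    obtain ⟨k, hk, hk'⟩ := ((isUniversalCowedge_iff.1 h).inv₂ I).existsUnique w' f
      fun j => he' j.1 j.2
    refine ⟨k, fun c => (Category.assoc _ _ _).trans (congrArg _ (hk c)), fun l hl => ?_⟩
    exact hk' l fun c => (cancel_epi (I.invComp (φ.hom c a) (ψ.hom d c)).hom).1
      ((Category.assoc _ _ _).symm.trans (hl c))

/-- The image of the domain compatibility of a composite: `invComp` is natural in the acting
2-cells, and its coherence with the associator regroups the three factors. -/
theorem oppCod_comp (φ : Dist X Y) (ψ : Dist Y Z) (χ : Dist X Z) (a₁ a₂ : X.carrier)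
    (d : Z.carrier) (c : Y.carrier) {e₁ : φ.hom c a₁ ≫ ψ.hom d c ⟶ χ.hom d a₁}
    {e₂ : φ.hom c a₂ ≫ ψ.hom d c ⟶ χ.hom d a₂}
    (h : X.M a₂ a₁ ◁ e₂ ≫ χ.actDom d a₂ a₁ =
      (α_ _ _ _).inv ≫ φ.actDom c a₂ a₁ ▷ ψ.hom d c ≫ e₁) :
    ((I.invComp (φ.hom c a₂) (ψ.hom d c)).hom ≫ I.inv₂ e₂) ▷ X.M a₁ a₂ ≫ oppCod hX χ a₁ a₂ d =
      (α_ _ _ _).hom ≫ I.inv (ψ.hom d c) ◁ oppCod hX φ a₁ a₂ c ≫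
        (I.invComp (φ.hom c a₁) (ψ.hom d c)).hom ≫ I.inv₂ e₁ := by
  calc
    _ = _ ◁ hX.cell a₁ a₂ ≫ (I.invComp (φ.hom c a₂) (ψ.hom d c)).hom ▷ I.inv (X.M a₂ a₁) ≫
          (I.invComp (X.M a₂ a₁) (φ.hom c a₂ ≫ ψ.hom d c)).hom ≫
          I.inv₂ (X.M a₂ a₁ ◁ e₂ ≫ χ.actDom d a₂ a₁) := by
      rw [oppCod, ← whisker_exchange_assoc, comp_whiskerRight, Category.assoc, I.inv₂_comp,
        reassoc_of% I.invComp_naturality_right]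
    _ = _ ◁ hX.cell a₁ a₂ ≫ ((α_ _ _ _).hom ≫ I.inv (ψ.hom d c) ◁
          (I.invComp (X.M a₂ a₁) (φ.hom c a₂)).hom ≫
          (I.invComp (X.M a₂ a₁ ≫ φ.hom c a₂) (ψ.hom d c)).hom) ≫
          I.inv₂ (φ.actDom c a₂ a₁ ▷ ψ.hom d c) ≫ I.inv₂ e₁ := by
      rw [h, I.inv₂_comp, I.inv₂_comp, ← I.invComp_assoc_inv]
      simp only [Category.assoc]
    _ = _ := by
      simp only [Category.assoc]
      rw [← reassoc_of% I.invComp_naturality_left, oppCod]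
      bicategory

theorem oppDom_comp (φ : Dist X Y) (ψ : Dist Y Z) (χ : Dist X Z) (a : X.carrier)
    (d₂ d₁ : Z.carrier) (c : Y.carrier) {e₁ : φ.hom c a ≫ ψ.hom d₁ c ⟶ χ.hom d₁ a}
    {e₂ : φ.hom c a ≫ ψ.hom d₂ c ⟶ χ.hom d₂ a}
    (h : e₂ ▷ Z.M d₁ d₂ ≫ χ.actCod d₁ d₂ a =
      (α_ _ _ _).hom ≫ φ.hom c a ◁ ψ.actCod d₁ d₂ c ≫ e₁) :
    Z.M d₂ d₁ ◁ ((I.invComp (φ.hom c a) (ψ.hom d₂ c)).hom ≫ I.inv₂ e₂) ≫ oppDom hZ χ a d₂ d₁ =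
      (α_ _ _ _).inv ≫ oppDom hZ ψ c d₂ d₁ ▷ I.inv (φ.hom c a) ≫
        (I.invComp (φ.hom c a) (ψ.hom d₁ c)).hom ≫ I.inv₂ e₁ := by
  calc
    _ = hZ.cell d₂ d₁ ▷ _ ≫ I.inv (Z.M d₁ d₂) ◁ (I.invComp (φ.hom c a) (ψ.hom d₂ c)).hom ≫
          (I.invComp (φ.hom c a ≫ ψ.hom d₂ c) (Z.M d₁ d₂)).hom ≫
          I.inv₂ (e₂ ▷ Z.M d₁ d₂ ≫ χ.actCod d₁ d₂ a) := by
      rw [oppDom, whisker_exchange_assoc, Bicategory.whiskerLeft_comp, Category.assoc,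
        I.inv₂_comp, reassoc_of% I.invComp_naturality_left]
    _ = hZ.cell d₂ d₁ ▷ _ ≫ ((α_ _ _ _).inv ≫
          (I.invComp (ψ.hom d₂ c) (Z.M d₁ d₂)).hom ▷ I.inv (φ.hom c a) ≫
          (I.invComp (φ.hom c a) (ψ.hom d₂ c ≫ Z.M d₁ d₂)).hom) ≫
          I.inv₂ (φ.hom c a ◁ ψ.actCod d₁ d₂ c) ≫ I.inv₂ e₁ := by
      rw [h, I.inv₂_comp, I.inv₂_comp, ← I.invComp_assoc]
      simp only [Category.assoc]
    _ = _ := by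
      simp only [Category.assoc]
      rw [← reassoc_of% I.invComp_naturality_right, oppDom]
      bicategory

/-- The involution preserves the coends, and it exchanges the domain and codomain halves of
bilinearity. -/
theorem isComposite_opp {φ : Dist X Y} {ψ : Dist Y Z} {χ : Dist X Z}
    {e : ∀ d a c, φ.hom c a ≫ ψ.hom d c ⟶ χ.hom d a} (h : IsComposite φ ψ χ e) :
    IsComposite (opp hY hZ ψ) (opp hX hY φ) (opp hX hZ χ)
      (fun a d c => (I.invComp (φ.hom c a) (ψ.hom d c)).hom ≫ I.inv₂ (e d a c)) := by
  have hu := fun a d => isUniversalCowedge_opp hX hY hZ (h.universal d a)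
  refine IsBilinear.isComposite ⟨fun a d => (hu a d).isCowedge, fun a₁ a₂ d c => ?_,
    fun a d₂ d₁ c => ?_⟩ hu
  · rw [opp_actCod, opp_actCod]
    exact oppCod_comp hX φ ψ χ a₁ a₂ d c (h.isBilinear.actDom d a₂ a₁ c)
  · rw [opp_actDom, opp_actDom]
    exact oppDom_comp hZ φ ψ χ a d₂ d₁ c (h.isBilinear.actCod d₁ d₂ a c)

end Opposite

/-! ### The involution on symmetric enriched categories. -/

section InducedInvolution

variable {K : DistComposition.{s} B} (hB : IsClosedBicategory B) {I : Involution B}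
  {X Y Z W : BCat.{s} B} (hX : IsSymmetric I X) (hY : IsSymmetric I Y) (hZ : IsSymmetric I Z)
  (hW : IsSymmetric I W)

theorem exists_oppComp (hB : IsClosedBicategory B) (φ : Dist X Y) (ψ : Dist Y Z) :
    ∃ i : K.comp (opp hY hZ ψ) (opp hX hY φ) ≅ opp hX hZ (K.comp φ ψ), ∀ a d c,
      K.e (opp hY hZ ψ) (opp hX hY φ) a d c ≫ DistHom.app i.hom a d =
        (I.invComp (φ.hom c a) (ψ.hom d c)).hom ≫ I.inv₂ (K.e φ ψ d a c) :=
  (K.isComposite _ _).exists_iso hB (isComposite_opp hX hY hZ (K.isComposite φ ψ))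

/-- The comparison of the composite of the opposites with the opposite of the composite. -/
noncomputable def oppComp (φ : Dist X Y) (ψ : Dist Y Z) :
    K.comp (opp hY hZ ψ) (opp hX hY φ) ≅ opp hX hZ (K.comp φ ψ) :=
  (exists_oppComp hX hY hZ hB φ ψ).choose

theorem e_oppComp (φ : Dist X Y) (ψ : Dist Y Z) (a : X.carrier) (d : Z.carrier) (c : Y.carrier) :
    K.e (opp hY hZ ψ) (opp hX hY φ) a d c ≫ DistHom.app (oppComp hB hX hY hZ φ ψ).hom a d =
      (I.invComp (φ.hom c a) (ψ.hom d c)).hom ≫ I.inv₂ (K.e φ ψ d a c) :=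
  (exists_oppComp hX hY hZ hB φ ψ).choose_spec a d c

theorem oppMap_id (φ : Dist X Y) : oppMap hX hY (𝟙 φ) = 𝟙 (opp hX hY φ) :=
  DistHom.ext (funext fun _ => funext fun _ => I.inv₂_id _)

theorem oppMap_comp {φ₁ φ₂ φ₃ : Dist X Y} (f : φ₁ ⟶ φ₂) (g : φ₂ ⟶ φ₃) :
    oppMap hX hY (f ≫ g) = oppMap hX hY f ≫ oppMap hX hY g :=
  DistHom.ext (funext fun _ => funext fun _ => I.inv₂_comp _ _)

theorem oppComp_naturality_left {φ φ' : Dist X Y} (f : φ ⟶ φ') (ψ : Dist Y Z) :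
    K.whiskerLeft hB (opp hY hZ ψ) (oppMap hX hY f) ≫ (oppComp hB hX hY hZ φ' ψ).hom =
      (oppComp hB hX hY hZ φ ψ).hom ≫ oppMap hX hZ (K.whiskerRight hB f ψ) :=
  DistComposition.hom_ext fun a d c => by
    rw [comp_app, comp_app, reassoc_of% K.e_whiskerLeft, e_oppComp, reassoc_of% e_oppComp,
      oppMap_app, oppMap_app]
    rw [← I.inv₂_comp, K.e_whiskerRight, I.inv₂_comp,
      reassoc_of% I.invComp_naturality_left]

theorem oppComp_naturality_right (φ : Dist X Y) {ψ ψ' : Dist Y Z} (f : ψ ⟶ ψ') :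
    K.whiskerRight hB (oppMap hY hZ f) (opp hX hY φ) ≫ (oppComp hB hX hY hZ φ ψ').hom =
      (oppComp hB hX hY hZ φ ψ).hom ≫ oppMap hX hZ (K.whiskerLeft hB φ f) :=
  DistComposition.hom_ext fun a d c => by
    rw [comp_app, comp_app, reassoc_of% K.e_whiskerRight, e_oppComp, reassoc_of% e_oppComp,
      oppMap_app, oppMap_app]
    rw [← I.inv₂_comp, K.e_whiskerLeft, I.inv₂_comp,
      reassoc_of% I.invComp_naturality_right]

theorem e_associator_inv (φ : Dist X Y) (ψ : Dist Y Z) (χ : Dist Z W) (x : W.carrier)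
    (a : X.carrier) (c : Y.carrier) (d : Z.carrier) :
    φ.hom c a ◁ K.e ψ χ x c d ≫ K.e φ (K.comp ψ χ) x a c ≫
        DistHom.app (K.associator hB φ ψ χ).inv x a =
      (α_ _ _ _).inv ≫ K.e φ ψ d a c ▷ χ.hom x d ≫ K.e (K.comp φ ψ) χ x a d := by
  have h : DistHom.app (K.associator hB φ ψ χ).hom x a ≫
      DistHom.app (K.associator hB φ ψ χ).inv x a = 𝟙 _ := by
    rw [← comp_app, Iso.hom_inv_id, id_app]
  rw [← cancel_epi (α_ _ _ _).hom, Iso.hom_inv_id_assoc, ← reassoc_of% K.e_associator hB, h,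
    Category.comp_id]

/-- On generators, naturality collects the structural 2-cells of the base involution, and the
equation becomes its coherence law `invComp_assoc`. -/
theorem oppComp_assoc (φ : Dist X Y) (ψ : Dist Y Z) (χ : Dist Z W) :
    K.whiskerLeft hB (opp hZ hW χ) (oppComp hB hX hY hZ φ ψ).hom ≫
        (oppComp hB hX hZ hW (K.comp φ ψ) χ).hom ≫
        oppMap hX hW (K.associator hB φ ψ χ).hom =
      (K.associator hB (opp hZ hW χ) (opp hY hZ ψ) (opp hX hY φ)).inv ≫
        K.whiskerRight hB (oppComp hB hY hZ hW ψ χ).hom (opp hX hY φ) ≫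
        (oppComp hB hX hY hW φ (K.comp ψ χ)).hom :=
  DistComposition.hom_ext_right hB fun a x d c => by
    rw [comp_app, comp_app, comp_app, comp_app, reassoc_of% e_associator_inv,
      reassoc_of% K.e_whiskerLeft, ← Bicategory.whiskerLeft_comp_assoc, e_oppComp,
      reassoc_of% e_oppComp, reassoc_of% K.e_whiskerRight, ← Bicategory.comp_whiskerRight_assoc,
      e_oppComp, e_oppComp, oppMap_app]
    have h := congrArg I.inv₂ (K.e_associator hB φ ψ χ x a c d)
    simp only [I.inv₂_comp] at h
    rw [Bicategory.whiskerLeft_comp, Bicategory.comp_whiskerRight, Category.assoc, Category.assoc,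
      reassoc_of% I.invComp_naturality_left, reassoc_of% I.invComp_naturality_right,
      h, reassoc_of% I.invComp_assoc]

/-- Both sides send the generators to the codomain action of the opposite, which was defined from
the domain action of `φ` by precisely this composite. -/
theorem oppComp_id_left (φ : Dist X Y) :
    K.whiskerLeft hB (opp hX hY φ) (oppId hX).hom ≫ (oppComp hB hX hX hY (idDist X) φ).hom ≫
        oppMap hX hY (K.leftUnitor hB φ).hom = (K.rightUnitor hB (opp hX hY φ)).hom :=
  DistComposition.hom_ext fun a c a' => by
    rw [comp_app, comp_app, reassoc_of% K.e_whiskerLeft, reassoc_of% e_oppComp, oppMap_app,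
      ← I.inv₂_comp, K.e_leftUnitor, K.e_rightUnitor, opp_actCod]
    rfl

theorem oppComp_id_right (φ : Dist X Y) :
    K.whiskerRight hB (oppId hY).hom (opp hX hY φ) ≫ (oppComp hB hX hY hY φ (idDist Y)).hom ≫
        oppMap hX hY (K.rightUnitor hB φ).hom = (K.leftUnitor hB (opp hX hY φ)).hom :=
  DistComposition.hom_ext fun a c c' => by
    rw [comp_app, comp_app, reassoc_of% K.e_whiskerRight, reassoc_of% e_oppComp, oppMap_app,
      ← I.inv₂_comp, K.e_rightUnitor, K.e_leftUnitor, opp_actDom]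
    rfl

/-- The two structural 2-cells cancel by `invComp_invComp`, so applying the construction twice
returns the original action up to transport. -/
theorem oppCod_opp (φ : Dist X Y) (c c' : Y.carrier) (a : X.carrier) :
    I.inv (I.inv (φ.hom c' a)) ◁ hY.cell c c' ≫
        (I.invComp (Y.M c' c) (I.inv (φ.hom c' a))).hom ≫ I.inv₂ (oppDom hY φ a c' c) =
      eqToHom (I.inv_inv (φ.hom c' a)) ▷ Y.M c c' ≫ φ.actCod c c' a ≫
        eqToHom (I.inv_inv (φ.hom c a)).symm := by
  rw [oppDom, I.inv₂_comp, I.inv₂_comp, ← reassoc_of% I.invComp_naturality_left,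
    reassoc_of% I.invComp_invComp, I.inv₂_inv₂, I.inv₂_eqToHom]
  simp

theorem oppDom_opp (φ : Dist X Y) (c : Y.carrier) (a' a : X.carrier) :
    hX.cell a' a ▷ I.inv (I.inv (φ.hom c a')) ≫
        (I.invComp (I.inv (φ.hom c a')) (X.M a a')).hom ≫ I.inv₂ (oppCod hX φ a a' c) =
      X.M a' a ◁ eqToHom (I.inv_inv (φ.hom c a')) ≫ φ.actDom c a' a ≫
        eqToHom (I.inv_inv (φ.hom c a)).symm := by
  rw [oppCod, I.inv₂_comp, I.inv₂_comp, ← reassoc_of% I.invComp_naturality_right,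
    reassoc_of% I.invComp_invComp, I.inv₂_inv₂, I.inv₂_eqToHom]
  simp

theorem opp_opp (φ : Dist X Y) : opp hY hX (opp hX hY φ) = φ := by
  refine Dist.eq_of_hom ⟨fun c a => eqToHom (I.inv_inv (φ.hom c a)), fun c c' a => ?_,
    fun c a' a => ?_⟩ (fun c a => I.inv_inv (φ.hom c a)) fun _ _ => rfl
  · rw [opp_actCod, oppCod, opp_actDom, oppCod_opp]
    simp
  · rw [opp_actDom, oppDom, opp_actCod, oppDom_opp]
    simp

theorem oppMap_oppMap {φ ψ : Dist X Y} (f : φ ⟶ ψ) :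
    oppMap hY hX (oppMap hX hY f) =
      eqToHom (opp_opp hX hY φ) ≫ f ≫ eqToHom (opp_opp hX hY ψ).symm :=
  DistHom.ext (funext fun c => funext fun a => by
    rw [comp_app, comp_app, eqToHom_app, eqToHom_app, oppMap_app, oppMap_app]
    exact I.inv₂_inv₂ _)

theorem oppId_oppId : (oppId hX).hom ≫ oppMap hX hX (oppId hX).hom =
    eqToHom (opp_opp hX hX (idDist X)).symm :=
  DistHom.ext (funext fun a => funext fun a' => by
    rw [comp_app, eqToHom_app, oppMap_app, oppId_hom_app, oppId_hom_app]
    exact (congrArg (_ ≫ ·) (I.inv₂_eqToHom _)).trans (eqToHom_trans _ _))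

/-- The type of a generator depends on both distributors, so replacing them by equal ones has to
transport its source and target too. -/
theorem e_eqToHom {φ φ' : Dist X Y} {ψ ψ' : Dist Y Z} (hφ : φ = φ') (hψ : ψ = ψ')
    (d : Z.carrier) (a : X.carrier) (c : Y.carrier) {w : X.typ a ⟶ Z.typ d}
    (h : (K.comp φ ψ).hom d a = w) (h' : (K.comp φ' ψ').hom d a = w) :
    K.e φ ψ d a c ≫ eqToHom h =
      eqToHom (congrArg₂ (fun (φ : Dist X Y) (ψ : Dist Y Z) => φ.hom c a ≫ ψ.hom d c) hφ hψ) ≫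
        K.e φ' ψ' d a c ≫ eqToHom h' := by
  subst hφ hψ
  simp

theorem oppComp_oppComp (φ : Dist X Y) (ψ : Dist Y Z) :
    (oppComp hB hZ hY hX (opp hY hZ ψ) (opp hX hY φ)).hom ≫
        oppMap hZ hX (oppComp hB hX hY hZ φ ψ).hom =
      eqToHom ((congrArg₂ K.comp (opp_opp hX hY φ) (opp_opp hY hZ ψ)).trans
        (opp_opp hX hZ (K.comp φ ψ)).symm) :=
  DistComposition.hom_ext fun d a c => by
    rw [comp_app, reassoc_of% e_oppComp, oppMap_app, ← I.inv₂_comp, e_oppComp, I.inv₂_comp,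
      eqToHom_app, reassoc_of% I.invComp_invComp, I.inv₂_inv₂]
    rw [e_eqToHom (opp_opp hX hY φ) (opp_opp hY hZ ψ) d a c _ (I.inv_inv _).symm]
    exact eqToHom_trans_assoc _ _ _

/-- The involution of the bicategory of symmetric enriched categories. -/
noncomputable def inducedInvolution (K : DistComposition.{s} B) (hB : IsClosedBicategory B)
    (I : Involution B) : Involution (DistSym (distBicategoryOn K hB) I) where
  inv {X Y} φ := opp X.2 Y.2 φ
  inv₂ {X Y _ _} f := oppMap X.2 Y.2 f
  inv₂_id {X Y} φ := oppMap_id X.2 Y.2 φ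
  inv₂_comp {X Y _ _ _} f g := oppMap_comp X.2 Y.2 f g
  invId X := oppId X.2
  invComp {X Y Z} φ ψ := oppComp hB X.2 Y.2 Z.2 φ ψ
  invComp_naturality_left {X Y Z _ _} f ψ := oppComp_naturality_left hB X.2 Y.2 Z.2 f ψ
  invComp_naturality_right {X Y Z} φ _ _ f := oppComp_naturality_right hB X.2 Y.2 Z.2 φ f
  invComp_assoc {X Y Z W} φ ψ χ := oppComp_assoc hB X.2 Y.2 Z.2 W.2 φ ψ χ
  invComp_id_left {X Y} φ := oppComp_id_left hB X.2 Y.2 φ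
  invComp_id_right {X Y} φ := oppComp_id_right hB X.2 Y.2 φ
  inv_inv {X Y} φ := opp_opp X.2 Y.2 φ
  inv₂_inv₂ {X Y _ _} f := oppMap_oppMap X.2 Y.2 f
  invId_invId X := oppId_oppId X.2
  invComp_invComp {X Y Z} φ ψ := oppComp_oppComp hB X.2 Y.2 Z.2 φ ψ

/-- For the constructed opposite the equality `hom_eq` is reflexivity, so the transports along it
are identities. -/
theorem isInducedInvolution_inducedInvolution (K : DistComposition.{s} B)
    (hB : IsClosedBicategory B) (I : Involution B) :
    IsInducedInvolution (distBicategoryOn K hB) I (inducedInvolution K hB I) where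
  inv_eq X Y φ := opp_isOpposite X.2 Y.2 φ
  inv₂_eq X Y φ₁ φ₂ f a c := (Category.comp_id _).trans (Category.id_comp _).symm
  invId_eq X a a' := Category.comp_id _
  invComp_eq X Y Z φ ψ a d c := by
    refine Eq.trans ?_ (Category.id_comp _).symm
    exact (congrArg _ (Category.comp_id _)).trans (e_oppComp hB X.2 Y.2 Z.2 φ ψ a d c)

end InducedInvolution

end EnrichedBicat

/-! ### Assembly of the four claims. -/

open EnrichedBicat in
theorem mainTheorem4 {B : Type u} [Bicategory.{w, v} B]
    (hcocomplete : IsLocallyCocomplete.{s} B) (hclosed : IsClosedBicategory B) :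
    Nonempty (DistComposition.{s} B) ∧
    (∀ (X Y : BCat.{s} B) (φ : Dist X Y),
      IsComposite (idDist X) φ φ (fun c a a' => φ.actDom c a' a) ∧
      IsComposite φ (idDist Y) φ (fun c a c' => φ.actCod c c' a)) ∧
    (∀ K : DistComposition.{s} B, ∃ S : DistBicategoryOn K, S.IsCanonical ∧
      ∀ I : Involution B, ∃ J : Involution (DistSym S I), IsInducedInvolution S I J) := by
  refine ⟨?_, fun X Y φ => ⟨isComposite_idDist_left φ, isComposite_idDist_right φ⟩, fun K =>
    ⟨distBicategoryOn K hclosed, distBicategoryOn_isCanonical K hclosed, fun I =>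
      ⟨inducedInvolution K hclosed I, isInducedInvolution_inducedInvolution K hclosed I⟩⟩⟩
  -- Local cocompleteness enters only here: a given choice of composites already carries its coends.
  choose comp e h using fun (X Y Z : BCat.{s} B) (φ : Dist X Y) (ψ : Dist Y Z) =>
    exists_isComposite hcocomplete hclosed φ ψ
  exact ⟨⟨fun φ ψ => comp _ _ _ φ ψ, fun φ ψ => e _ _ _ φ ψ, fun φ ψ => h _ _ _ φ ψ⟩⟩
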